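/- Let $p,q$ be coprime complex polynomials with $p\neq 0$, let $f=q/p$, and let $u=\mathcal S(f):\mathbb R^2=\mathbb C\to\mathbb S^2\subset\mathbb R^3$, where $\mathcal S(w)=\frac{1}{1+|w|^2}\left(2\,\mathrm{Re}\,w,\,2\,\mathrm{Im}\,w,\,|w|^2-1\right)$ is the stereographic parametrization and $u$ takes the value $(0,0,1)$ at the poles of $f$. (Such a $u$ is a harmonic map.) Let $m\ge 0$ be its degree, $m=\frac1{4\pi}\int_{\mathbb R^2}u_x\cdot(u\times u_y)$. Let $L_{1,u}[v]=v_x-v\times u_y-u\times v_y$, and let $\ker L_{1,u}$ be the real vector space of all $C^2$ maps $v:\mathbb C\to\mathbb R^3$ with $v(z)\cdot u(z)=0$ for all $z$, with $\sup_{z\in\mathbb C}\left(|v(z)|+|\partial v(z)|+|\partial^2v(z)|\right)<\infty$, and with $L_{1,u}[v]=0$. Then: (1) $\ker L_{1,u}$ is the real linear span of the maps obtained by differentiating $\mathcal S(q/p)$ with respect to the real and imaginary parts of the coefficients of $1,z,\dots,z^m$ in $p$ and in $q$. Moreover, a map $v:\mathbb C\to\mathbb R^3$ lies in $\ker L_{1,u}$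 if and only if there are complex polynomials $P,Q$ of degree at most $m$ such that $v(z)=\frac{d}{dt}\big|_{t=0}\mathcal S\!\left(\frac{q+tQ}{p+tP}\right)(z)$ for all $z\in\mathbb C$ ($t$ real). (2) For every $v\in\ker L_{1,u}$ the function $z\mapsto D\mathcal S^{-1}_{u(z)}(v(z))$, where $\mathcal S^{-1}(s)=\frac{s_1+is_2}{1-s_3}$, is holomorphic on $\mathbb C$ minus the poles of $f$. (3) $\dim_{\mathbb R}\ker L_{1,u}=4m+2$. -/

import Mathlib

open Polynomial Matrix MeasureTheory

noncomputable section

/-- Stereographic parametrization of the unit sphere of `ℝ³` minus the north pole. Points of `ℝ³`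
are written as elements of `Fin 3 → ℝ`, with dot product `⬝ᵥ` and cross product `⨯₃`. -/
def stereo (w : ℂ) : Fin 3 → ℝ :=
  ![2 * w.re / (1 + ‖w‖ ^ 2), 2 * w.im / (1 + ‖w‖ ^ 2), (‖w‖ ^ 2 - 1) / (‖w‖ ^ 2 + 1)]

/-- The stereographic coordinate `(s₁ + i s₂) / (1 - s₃)`, inverse to `stereo` on the sphere minus
the north pole. -/
def stereoCoord (s : Fin 3 → ℝ) : ℂ :=
  ((s 0 : ℂ) + (s 1 : ℂ) * Complex.I) / (1 - (s 2 : ℂ))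

/-- The map `𝒮(q/p)` from the plane to the sphere; the poles of `q/p` go to the north pole. -/
def ratSphere (p q : ℂ[X]) (z : ℂ) : Fin 3 → ℝ :=
  if p.eval z = 0 then ![0, 0, 1] else stereo (q.eval z / p.eval z)

/-- Partial derivative in the first (real) coordinate direction of `ℂ = ℝ²`. -/
def dx (v : ℂ → Fin 3 → ℝ) (z : ℂ) : Fin 3 → ℝ := fderiv ℝ v z 1

/-- Partial derivative in the second (imaginary) coordinate direction of `ℂ = ℝ²`. -/
def dy (v : ℂ → Fin 3 → ℝ) (z : ℂ) : Fin 3 → ℝ := fderiv ℝ v z Complex.I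

/-- Degree of a map from the plane to the sphere: `(1 / 4π) ∫ u_x · (u × u_y)`. -/
def sphereDegree (u : ℂ → Fin 3 → ℝ) : ℝ :=
  1 / (4 * Real.pi) * ∫ z : ℂ, dx u z ⬝ᵥ (u z ⨯₃ dy u z)

/-- The linearization of `u_x = u × u_y` at `u`: `L₁[v] = v_x - v × u_y - u × v_y`. -/
def L1 (u v : ℂ → Fin 3 → ℝ) (z : ℂ) : Fin 3 → ℝ :=
  dx v z - v z ⨯₃ dy u z - u z ⨯₃ dy v z

/-- The bounded kernel of `L1 u`: the `C²` vector fields `v` along `u`, tangent to the sphere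
(`v z ⟂ u z`), bounded together with their derivatives of order one and two, with `L₁[v] = 0`. -/
def kerL1 (u : ℂ → Fin 3 → ℝ) : Submodule ℝ (ℂ → Fin 3 → ℝ) where
  carrier := {v | ContDiff ℝ 2 v ∧ (∀ z, u z ⬝ᵥ v z = 0) ∧
    (∃ C : ℝ, ∀ z, ‖v z‖ + ‖fderiv ℝ v z‖ + ‖iteratedFDeriv ℝ 2 v z‖ ≤ C) ∧
    ∀ z, L1 u v z = 0}
  zero_mem' := by
    refine ⟨contDiff_const, fun z => by simp, ⟨0, fun z => ?_⟩, fun z => ?_⟩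
    · have h : iteratedFDeriv ℝ 2 (0 : ℂ → Fin 3 → ℝ) = 0 := iteratedFDeriv_fun_zero
      simp [h]
    · simp [L1, dx, dy]
  add_mem' := by
    rintro v w ⟨hv, hv', ⟨C, hC⟩, hL⟩ ⟨hw, hw', ⟨D, hD⟩, hM⟩
    have e1 (z : ℂ) : fderiv ℝ (v + w) z = fderiv ℝ v z + fderiv ℝ w z :=
      fderiv_add (hv.differentiable (by norm_num) z) (hw.differentiable (by norm_num) z)
    have e2 (z : ℂ) : iteratedFDeriv ℝ 2 (v + w) z
        = iteratedFDeriv ℝ 2 v z + iteratedFDeriv ℝ 2 w z :=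
      iteratedFDeriv_add_apply hv.contDiffAt hw.contDiffAt
    refine ⟨hv.add hw, fun z => by simp [dotProduct_add, hv', hw'], ⟨C + D, fun z => ?_⟩,
      fun z => ?_⟩
    · rw [e1, e2, Pi.add_apply]
      linarith [hC z, hD z, norm_add_le (v z) (w z), norm_add_le (fderiv ℝ v z) (fderiv ℝ w z),
        norm_add_le (iteratedFDeriv ℝ 2 v z) (iteratedFDeriv ℝ 2 w z)]
    · have h1 := hL z
      have h2 := hM z
      simp only [L1, dx, dy] at h1 h2 ⊢
      rw [e1]
      simp only [Pi.add_apply, _root_.add_apply, map_add, LinearMap.add_apply]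
      linear_combination (exp := 1) h1 + h2
  smul_mem' := by
    rintro c v ⟨hv, hv', ⟨C, hC⟩, hL⟩
    have e1 (z : ℂ) : fderiv ℝ (c • v) z = c • fderiv ℝ v z :=
      fderiv_const_smul (hv.differentiable (by norm_num) z) c
    have e2 (z : ℂ) : iteratedFDeriv ℝ 2 (c • v) z = c • iteratedFDeriv ℝ 2 v z :=
      iteratedFDeriv_const_smul_apply hv.contDiffAt
    refine ⟨hv.const_smul c, fun z => by simp [hv'], ⟨|c| * C, fun z => ?_⟩, fun z => ?_⟩
    · rw [e1, e2, Pi.smul_apply, norm_smul, norm_smul, norm_smul, Real.norm_eq_abs, ← mul_add,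
        ← mul_add]
      exact mul_le_mul_of_nonneg_left (hC z) (abs_nonneg c)
    · have h1 := hL z
      simp only [L1, dx, dy] at h1 ⊢
      rw [e1]
      simp only [Pi.smul_apply, _root_.smul_apply, map_smul, LinearMap.smul_apply,
        ← smul_sub, h1, smul_zero]

/-- `v` is the derivative at `t = 0` of `𝒮((q + tQ)/(p + tP))`: the variation of `𝒮(q/p)` obtained
by moving the coefficients of `p` and `q` in the directions `P` and `Q`. -/
def IsCoeffVariation (p q P Q : ℂ[X]) (v : ℂ → Fin 3 → ℝ) : Prop :=
  ∀ z : ℂ, HasDerivAt (fun t : ℝ => ratSphere (p + C (t : ℂ) * P) (q + C (t : ℂ) * Q) z) (v z) 0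

/-- The derivatives of `𝒮(q/p)` with respect to the real (`c = 1`) and imaginary (`c = i`) parts of
the coefficients of `1, z, …, zᵐ` in `p` and in `q`. -/
def coeffVariations (p q : ℂ[X]) (m : ℕ) : Set (ℂ → Fin 3 → ℝ) :=
  {v | ∃ j ≤ m, ∃ c : ℂ, (c = 1 ∨ c = Complex.I) ∧
    (IsCoeffVariation p q (C c * X ^ j) 0 v ∨ IsCoeffVariation p q 0 (C c * X ^ j) v)}

end

/-! Lift u to homogeneous coordinates (p, q): coprimality means no common zero, so poles need no
special treatment. A tangent vector at the point b/a of the sphere is encoded by one complex number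
ω, the wedge aB - bA of any direction (A, B) inducing it. In this coordinate the cross product with
u is multiplication by -i, and the change of frame along (p, q) is holomorphic. Hence L₁[v] = 0 for
a tangent field v says exactly that ω is entire (`IsCoprime.L1_eq_zero_iff`).

Let d = max(deg p, deg q). Since |p|² + |q|² is comparable to (1 + |z|)^(2d), a bounded v has |ω| =
O((1 + |z|)^(2d)), and Liouville makes ω a polynomial of degree at most 2d. Conversely, every such
polynomial gives a field with bounded derivatives (`IsCoprime.symbolGrowth_tangentField`). So the
kernel is a copy of the complex polynomials of degree at most 2d, of real dimension 2(2d + 1). In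
the affine coordinate v becomes ω/p², holomorphic off the poles.

Moving (p, q) in the direction (P, Q) produces ω = pQ - qP; a Bézout argument with degree control
shows that every polynomial of degree at most 2d has this form (`exists_mul_sub_mul_eq`). Finally m
= d by Stokes: the Jacobian of u is a ∂̄-derivative of ∂ log(|p|² + |q|²), whose boundary integrals
over large circles converge to a multiple of d (`IsCoprime.integral_wronsk`). -/

noncomputable section

open ComplexConjugate Complex

/-! ### Algebra of the sphere and its tangent planes in homogeneous coordinates. -/

section

/-- The squared norm of the homogeneous coordinates `(a, b)`. -/
def homDen (a b : ℂ) : ℝ := normSq a + normSq b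

/-- The point `𝒮(b/a)` of the sphere in homogeneous coordinates. -/
def sphereHom (a b : ℂ) : Fin 3 → ℝ :=
  ![2 * (b * conj a).re / homDen a b, 2 * (b * conj a).im / homDen a b,
    (normSq b - normSq a) / homDen a b]

/-- The tangent vector at `sphereHom a b` with homogeneous coordinate `ω`: the derivative of
`sphereHom` at `(a, b)` in a direction `(A, B)` with `a B - b A = ω`. -/
def sphereTangent (a b ω : ℂ) : Fin 3 → ℝ :=
  ![2 * (ω * conj a ^ 2 - b ^ 2 * conj ω).re / homDen a b ^ 2,
    2 * (ω * conj a ^ 2 - b ^ 2 * conj ω).im / homDen a b ^ 2,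
    4 * (ω * conj a * conj b).re / homDen a b ^ 2]

/-- The homogeneous coordinate of a tangent vector at `sphereHom a b`. -/
def tangentCoord (a b : ℂ) (v : Fin 3 → ℝ) : ℂ :=
  (a ^ 2 * (v 0 + v 1 * I) + 2 * a * b * v 2 - b ^ 2 * (v 0 - v 1 * I)) / 2

lemma homDen_pos {a b : ℂ} (h : a ≠ 0 ∨ b ≠ 0) : 0 < homDen a b := by
  rcases h with h | h
  · exact add_pos_of_pos_of_nonneg (normSq_pos.2 h) (normSq_nonneg _)
  · exact add_pos_of_nonneg_of_pos (normSq_nonneg _) (normSq_pos.2 h)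

lemma homDen_expand (a b : ℂ) :
    homDen a b = a.re ^ 2 + a.im ^ 2 + (b.re ^ 2 + b.im ^ 2) := by
  simp [homDen, normSq_apply, pow_two]

lemma sphereHom_expand (a b : ℂ) :
    sphereHom a b = ![2 * (b.re * a.re + b.im * a.im) / homDen a b,
      2 * (b.im * a.re - b.re * a.im) / homDen a b,
      (b.re ^ 2 + b.im ^ 2 - (a.re ^ 2 + a.im ^ 2)) / homDen a b] := by
  simp [sphereHom, normSq_apply, pow_two]
  ring_nf

lemma sphereTangent_expand (a b ω : ℂ) :
    sphereTangent a b ω = ![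
      2 * (ω.re * (a.re ^ 2 - a.im ^ 2) + 2 * ω.im * a.re * a.im
        - (b.re ^ 2 - b.im ^ 2) * ω.re - 2 * b.re * b.im * ω.im) / homDen a b ^ 2,
      2 * (ω.im * (a.re ^ 2 - a.im ^ 2) - 2 * ω.re * a.re * a.im
        - 2 * b.re * b.im * ω.re + (b.re ^ 2 - b.im ^ 2) * ω.im) / homDen a b ^ 2,
      4 * (ω.re * (a.re * b.re - a.im * b.im) + ω.im * (a.re * b.im + a.im * b.re))
        / homDen a b ^ 2] := by
  ext i
  fin_cases i <;>
  · simp [sphereTangent, pow_two, -mul_eq_mul_left_iff, -mul_eq_mul_right_iff]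
    ring

lemma tangentCoord_re (a b : ℂ) (v : Fin 3 → ℝ) :
    (tangentCoord a b v).re = ((a.re ^ 2 - a.im ^ 2 - (b.re ^ 2 - b.im ^ 2)) * v 0
      - 2 * (a.re * a.im + b.re * b.im) * v 1 + 2 * (a.re * b.re - a.im * b.im) * v 2) / 2 := by
  simp [tangentCoord, pow_two]
  ring

lemma tangentCoord_im (a b : ℂ) (v : Fin 3 → ℝ) :
    (tangentCoord a b v).im = (2 * (a.re * a.im - b.re * b.im) * v 0
      + (a.re ^ 2 - a.im ^ 2 + (b.re ^ 2 - b.im ^ 2)) * v 1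
      + 2 * (a.re * b.im + a.im * b.re) * v 2) / 2 := by
  simp [tangentCoord, pow_two]
  ring

lemma sphereHom_dot_self {a b : ℂ} (h : homDen a b ≠ 0) :
    sphereHom a b ⬝ᵥ sphereHom a b = 1 := by
  have e := homDen_expand a b
  rw [sphereHom_expand]
  generalize homDen a b = D at *
  simp only [dotProduct, Fin.sum_univ_three, Matrix.cons_val_zero, Matrix.cons_val_one,
    Matrix.cons_val]
  field_simp
  rw [e]
  ring

lemma sphereHom_dot_sphereTangent (a b ω : ℂ) :
    sphereHom a b ⬝ᵥ sphereTangent a b ω = 0 := by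
  rw [sphereHom_expand, sphereTangent_expand]
  simp only [dotProduct, Fin.sum_univ_three, Matrix.cons_val_zero, Matrix.cons_val_one,
    Matrix.cons_val]
  ring

lemma tangentCoord_sphereTangent {a b : ℂ} (h : homDen a b ≠ 0) (ω : ℂ) :
    tangentCoord a b (sphereTangent a b ω) = ω := by
  have e := homDen_expand a b
  apply Complex.ext
  all_goals
    simp only [tangentCoord_re, tangentCoord_im, sphereTangent_expand, Matrix.cons_val_zero,
      Matrix.cons_val_one, Matrix.cons_val]
    generalize homDen a b = D at *
    field_simp
    rw [e]
    ring

/-- For general v the left side is the tangential projection v - (u·v)u, which is why each component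
closes with a multiple of `hv`. -/
lemma sphereTangent_tangentCoord {a b : ℂ} (h : homDen a b ≠ 0) {v : Fin 3 → ℝ}
    (hv : sphereHom a b ⬝ᵥ v = 0) : sphereTangent a b (tangentCoord a b v) = v := by
  have e := homDen_expand a b
  rw [sphereHom_expand] at hv
  simp only [dotProduct, Fin.sum_univ_three, Matrix.cons_val_zero, Matrix.cons_val_one,
    Matrix.cons_val] at hv
  rw [sphereTangent_expand, tangentCoord_re, tangentCoord_im]
  generalize homDen a b = D at *
  field_simp at hv
  ext i
  fin_cases i
  · simp only [Fin.zero_eta, Matrix.cons_val_zero]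
    rw [div_eq_iff (pow_ne_zero 2 h), e]
    linear_combination (-2 * (b.re * a.re + b.im * a.im)) * hv
  · simp only [Fin.mk_one, Matrix.cons_val_zero, Matrix.cons_val_one]
    rw [div_eq_iff (pow_ne_zero 2 h), e]
    linear_combination (-2 * (b.im * a.re - b.re * a.im)) * hv
  · simp only [Fin.reduceFinMk, Matrix.cons_val]
    rw [div_eq_iff (pow_ne_zero 2 h), e]
    linear_combination (-(b.re ^ 2 + b.im ^ 2 - (a.re ^ 2 + a.im ^ 2))) * hv

/-- The cross product with u is the complex structure of the tangent plane, up to sign; this turns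
u_x = u × u_y into a Cauchy-Riemann equation. -/
lemma sphereHom_cross_sphereTangent {a b : ℂ} (h : homDen a b ≠ 0) (ω : ℂ) :
    sphereHom a b ⨯₃ sphereTangent a b (I * ω) = sphereTangent a b ω := by
  have e := homDen_expand a b
  rw [cross_apply, sphereHom_expand, sphereTangent_expand, sphereTangent_expand]
  simp only [I_mul_re, I_mul_im]
  generalize homDen a b = D at *
  ext i
  fin_cases i
  all_goals
    simp only [Fin.zero_eta, Fin.mk_one, Fin.reduceFinMk, Matrix.cons_val_zero,
      Matrix.cons_val_one, Matrix.cons_val]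
    field_simp
    rw [e]
    ring

lemma tangentCoord_sphereHom_cross {a b : ℂ} (h : homDen a b ≠ 0) (v : Fin 3 → ℝ) :
    tangentCoord a b (sphereHom a b ⨯₃ v) = -(I * tangentCoord a b v) := by
  have e := homDen_expand a b
  rw [cross_apply, sphereHom_expand]
  apply Complex.ext
  all_goals
    simp only [tangentCoord_re, tangentCoord_im, neg_re, neg_im, I_mul_re, I_mul_im,
      Matrix.cons_val_zero, Matrix.cons_val_one, Matrix.cons_val]
    generalize homDen a b = D at *
    field_simp
    rw [e]
    ring

lemma tangentCoord_smul_sphereHom (a b : ℂ) (c : ℝ) :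
    tangentCoord a b (c • sphereHom a b) = 0 := by
  rw [sphereHom_expand]
  apply Complex.ext
  all_goals
    simp only [tangentCoord_re, tangentCoord_im, Pi.smul_apply, Matrix.cons_val_zero,
      Matrix.cons_val_one, Matrix.cons_val, smul_eq_mul, zero_re, zero_im]
    ring

/-- The cross product of two tangent vectors of the unit sphere is normal. -/
lemma cross_eq_smul_of_dot_eq_zero {u v w : Fin 3 → ℝ} (hu : u ⬝ᵥ u = 1) (hv : u ⬝ᵥ v = 0)
    (hw : u ⬝ᵥ w = 0) : v ⨯₃ w = (u ⬝ᵥ v ⨯₃ w) • u := by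
  have key : u ⨯₃ (v ⨯₃ w) = 0 := by
    rw [cross_cross_eq_smul_sub_smul', dotProduct_comm v, hv, hw]; simp
  have := cross_cross_eq_smul_sub_smul' u u (v ⨯₃ w)
  rw [key, hu] at this
  rw [one_smul, map_zero] at this
  exact (sub_eq_zero.1 this.symm).symm

lemma sphereTangent_dot_self {a b : ℂ} (h : homDen a b ≠ 0) (ω : ℂ) :
    sphereTangent a b ω ⬝ᵥ sphereTangent a b ω = 4 * normSq ω / homDen a b ^ 2 := by
  have e := homDen_expand a b
  rw [sphereTangent_expand, normSq_apply]
  simp only [dotProduct, Fin.sum_univ_three, Matrix.cons_val_zero,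
    Matrix.cons_val_one, Matrix.cons_val]
  generalize homDen a b = D at *
  field_simp
  rw [e]
  ring

lemma sphereHom_eq_stereo {a : ℂ} (ha : a ≠ 0) (b : ℂ) : sphereHom a b = stereo (b / a) := by
  have h : homDen a b ≠ 0 := (homDen_pos (Or.inl ha)).ne'
  have h1 : normSq a ≠ 0 := (normSq_pos.2 ha).ne'
  have h2 : 1 + normSq b / normSq a = homDen a b / normSq a := by
    rw [homDen]; field_simp
  have h3 : normSq b / normSq a + 1 = homDen a b / normSq a := by rw [← h2, add_comm]
  rw [sphereHom, stereo]
  simp only [← normSq_eq_norm_sq, div_re, div_im, map_div₀, h2, h3]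
  congr 1
  · simp; field_simp
  congr 1
  · simp; field_simp; ring
  congr 1
  · field_simp

lemma sphereHom_zero_left {b : ℂ} (hb : b ≠ 0) : sphereHom 0 b = ![0, 0, 1] := by
  have : normSq b ≠ 0 := (normSq_pos.2 hb).ne'
  simp [sphereHom, homDen, hb]

lemma ratSphere_eq_sphereHom {p q : ℂ[X]} {z : ℂ} (h : p.eval z ≠ 0 ∨ q.eval z ≠ 0) :
    ratSphere p q z = sphereHom (p.eval z) (q.eval z) := by
  unfold ratSphere
  split_ifs with h0
  · rw [h0, sphereHom_zero_left (by tauto)]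
  · rw [sphereHom_eq_stereo h0]

end

/-! ### Calculus along 𝒮(q/p): the linearized equation as a Cauchy-Riemann equation. -/

section

/-- Only the wedge of (a, b) and (A, B) survives, because rescaling (a, b) does not move the point
of the sphere. -/
lemma hasDerivAt_sphereHom {a b : ℝ → ℂ} {A B : ℂ} {t : ℝ} (ha : HasDerivAt a A t)
    (hb : HasDerivAt b B t) (h : homDen (a t) (b t) ≠ 0) :
    HasDerivAt (fun s => sphereHom (a s) (b s))
      (sphereTangent (a t) (b t) (a t * B - b t * A)) t := by
  have ha1 : HasDerivAt (fun s => (a s).re) A.re t := reCLM.hasFDerivAt.comp_hasDerivAt t ha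
  have ha2 : HasDerivAt (fun s => (a s).im) A.im t := imCLM.hasFDerivAt.comp_hasDerivAt t ha
  have hb1 : HasDerivAt (fun s => (b s).re) B.re t := reCLM.hasFDerivAt.comp_hasDerivAt t hb
  have hb2 : HasDerivAt (fun s => (b s).im) B.im t := imCLM.hasFDerivAt.comp_hasDerivAt t hb
  have e := homDen_expand (a t) (b t)
  have hD := ((ha1.pow 2).add (ha2.pow 2)).add ((hb1.pow 2).add (hb2.pow 2))
  replace hD : HasDerivAt (fun s => homDen (a s) (b s)) _ t :=
    hD.congr_of_eventuallyEq (.of_forall fun s => homDen_expand _ _)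
  rw [hasDerivAt_pi]
  simp only [sphereHom_expand, sphereTangent_expand]
  intro i
  fin_cases i
  · refine ((((hb1.mul ha1).add (hb2.mul ha2)).const_mul 2).div hD h).congr_deriv ?_
    simp
    generalize homDen (a t) (b t) = D at *
    field_simp
    rw [e]
    ring
  · refine ((((hb2.mul ha1).sub (hb1.mul ha2)).const_mul 2).div hD h).congr_deriv ?_
    simp
    generalize homDen (a t) (b t) = D at *
    field_simp
    rw [e]
    ring
  · refine ((((hb1.pow 2).add (hb2.pow 2)).sub ((ha1.pow 2).add (ha2.pow 2))).div
      hD h).congr_deriv ?_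
    simp
    generalize homDen (a t) (b t) = D at *
    field_simp
    rw [e]
    ring

section Smooth

variable {E : Type*} [NormedAddCommGroup E] [NormedSpace ℝ E] {n : WithTop ℕ∞} {a b : E → ℂ}

lemma ContDiff.complex_re (ha : ContDiff ℝ n a) : ContDiff ℝ n (fun z => (a z).re) :=
  reCLM.contDiff.comp ha

lemma ContDiff.complex_im (ha : ContDiff ℝ n a) : ContDiff ℝ n (fun z => (a z).im) :=
  imCLM.contDiff.comp ha

lemma ContDiff.homDen (ha : ContDiff ℝ n a) (hb : ContDiff ℝ n b) :
    ContDiff ℝ n (fun z => homDen (a z) (b z)) := by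
  simp only [homDen_expand]
  exact ((ha.complex_re.pow 2).add (ha.complex_im.pow 2)).add
    ((hb.complex_re.pow 2).add (hb.complex_im.pow 2))

lemma ContDiff.sphereHom (ha : ContDiff ℝ n a) (hb : ContDiff ℝ n b)
    (h : ∀ z, _root_.homDen (a z) (b z) ≠ 0) : ContDiff ℝ n (fun z => _root_.sphereHom (a z) (b z)) := by
  have hD := ha.homDen hb
  have ha1 := ha.complex_re
  have ha2 := ha.complex_im
  have hb1 := hb.complex_re
  have hb2 := hb.complex_im
  rw [contDiff_pi]
  simp only [sphereHom_expand]
  intro i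
  fin_cases i
  · exact ContDiff.div (by fun_prop) hD h
  · exact ContDiff.div (by fun_prop) hD h
  · exact ContDiff.div (by fun_prop) hD h

end Smooth

variable {p q : ℂ[X]}

lemma IsCoprime.eval_ne_zero_or (hpq : IsCoprime p q) (z : ℂ) :
    p.eval z ≠ 0 ∨ q.eval z ≠ 0 := by
  obtain ⟨a, b, hab⟩ := hpq
  by_contra! hz
  have := congrArg (Polynomial.eval z) hab
  simp [hz.1, hz.2] at this

lemma IsCoprime.homDen_pos (hpq : IsCoprime p q) (z : ℂ) :
    0 < homDen (p.eval z) (q.eval z) :=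
  _root_.homDen_pos (hpq.eval_ne_zero_or z)

lemma IsCoprime.ratSphere_eq (hpq : IsCoprime p q) :
    ratSphere p q = fun z => sphereHom (p.eval z) (q.eval z) :=
  funext fun z => ratSphere_eq_sphereHom (hpq.eval_ne_zero_or z)

lemma Polynomial.contDiff_real (p : ℂ[X]) {n : WithTop ℕ∞} : ContDiff ℝ n (fun z => p.eval z) :=
  (show ContDiff ℂ n fun z => p.eval z by
    simpa using p.contDiff_aeval (𝕜 := ℂ) n).restrict_scalars ℝ

lemma IsCoprime.contDiff_ratSphere (hpq : IsCoprime p q) {n : WithTop ℕ∞} :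
    ContDiff ℝ n (ratSphere p q) := by
  rw [hpq.ratSphere_eq]
  exact p.contDiff_real.sphereHom q.contDiff_real fun z => (hpq.homDen_pos z).ne'

lemma hasDerivAt_add_mul (z e : ℂ) (t : ℝ) : HasDerivAt (fun t : ℝ => z + t * e) e t := by
  simpa using ((hasDerivAt_id t).ofReal_comp.mul_const e).const_add z

lemma Polynomial.hasDerivAt_line (p : ℂ[X]) (z e : ℂ) :
    HasDerivAt (fun t : ℝ => p.eval (z + t * e)) (p.derivative.eval z * e) 0 := by
  have := (p.hasDerivAt (z + (0 : ℝ) * e)).comp_of_eq (0 : ℝ) (hasDerivAt_add_mul z e 0) rfl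
  simpa [Function.comp_def] using this

lemma fderiv_apply_of_hasDerivAt_line {F : Type*} [NormedAddCommGroup F] [NormedSpace ℝ F]
    {f : ℂ → F} {z e : ℂ} {f' : F} (hf : DifferentiableAt ℝ f z)
    (h : HasDerivAt (fun t : ℝ => f (z + t * e)) f' 0) : fderiv ℝ f z e = f' := by
  have h2 := hf.hasFDerivAt.comp_hasDerivAt_of_eq (0 : ℝ) (hasDerivAt_add_mul z e 0) (by simp)
  exact h2.unique h

/-- The Wronskian `p q' - q p'`, the homogeneous coordinate of the derivative of `𝒮(q/p)`. -/
abbrev wronsk (p q : ℂ[X]) : ℂ[X] := p * derivative q - q * derivative p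

lemma IsCoprime.fderiv_ratSphere (hpq : IsCoprime p q) (z e : ℂ) :
    fderiv ℝ (ratSphere p q) z e
      = sphereTangent (p.eval z) (q.eval z) ((wronsk p q).eval z * e) := by
  apply fderiv_apply_of_hasDerivAt_line
    ((hpq.contDiff_ratSphere (n := 1)).differentiable one_ne_zero z)
  have h := hasDerivAt_sphereHom (p.hasDerivAt_line z e) (q.hasDerivAt_line z e)
    (by simpa using (hpq.homDen_pos z).ne')
  rw [hpq.ratSphere_eq]
  refine h.congr_deriv ?_
  simp [wronsk]
  ring_nf

lemma IsCoprime.dx_ratSphere (hpq : IsCoprime p q) (z : ℂ) :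
    dx (ratSphere p q) z
      = sphereTangent (p.eval z) (q.eval z) ((wronsk p q).eval z) := by
  rw [dx, hpq.fderiv_ratSphere, mul_one]

lemma IsCoprime.dy_ratSphere (hpq : IsCoprime p q) (z : ℂ) :
    dy (ratSphere p q) z
      = sphereTangent (p.eval z) (q.eval z) (I * (wronsk p q).eval z) := by
  rw [dy, hpq.fderiv_ratSphere, mul_comm]

lemma IsCoprime.dx_eq_cross_dy (hpq : IsCoprime p q) (z : ℂ) :
    dx (ratSphere p q) z = ratSphere p q z ⨯₃ dy (ratSphere p q) z := by
  rw [hpq.dx_ratSphere, hpq.dy_ratSphere, hpq.ratSphere_eq,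
    sphereHom_cross_sphereTangent (hpq.homDen_pos z).ne']

lemma tangentCoord_sub (a b : ℂ) (v w : Fin 3 → ℝ) :
    tangentCoord a b (v - w) = tangentCoord a b v - tangentCoord a b w := by
  simp [tangentCoord]
  ring

lemma norm_tangentCoord_le (a b : ℂ) (v : Fin 3 → ℝ) :
    ‖tangentCoord a b v‖ ≤ 2 * homDen a b * ‖v‖ := by
  have h (i) : ‖(v i : ℂ)‖ ≤ ‖v‖ := by simpa using norm_le_pi_norm v i
  have h1 : ‖(v 0 + v 1 * I : ℂ)‖ ≤ 2 * ‖v‖ := by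
    refine (norm_add_le _ _).trans ?_
    rw [norm_mul, norm_I]
    linarith [h 0, h 1]
  have h2 : ‖(v 0 - v 1 * I : ℂ)‖ ≤ 2 * ‖v‖ := by
    refine (norm_sub_le _ _).trans ?_
    rw [norm_mul, norm_I]
    linarith [h 0, h 1]
  rw [homDen, normSq_eq_norm_sq, normSq_eq_norm_sq, tangentCoord, norm_div]
  have h3 : ‖a ^ 2 * (v 0 + v 1 * I) + 2 * a * b * v 2 - b ^ 2 * (v 0 - v 1 * I)‖
      ≤ ‖a‖ ^ 2 * (2 * ‖v‖) + 2 * ‖a‖ * ‖b‖ * ‖v‖ + ‖b‖ ^ 2 * (2 * ‖v‖) := by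
    refine (norm_sub_le _ _).trans (add_le_add ((norm_add_le _ _).trans (add_le_add ?_ ?_)) ?_)
    · rw [norm_mul, norm_pow]; gcongr
    · rw [norm_mul, norm_mul, norm_mul, Complex.norm_two]; gcongr; exact h 2
    · rw [norm_mul, norm_pow]; gcongr
  have h4 : 0 ≤ (‖a‖ - ‖b‖) ^ 2 * ‖v‖ := by positivity
  have h5 : 0 ≤ (‖a‖ ^ 2 + ‖b‖ ^ 2) * ‖v‖ := by positivity
  rw [Complex.norm_two, div_le_iff₀ two_pos]
  nlinarith

variable {v : ℂ → Fin 3 → ℝ}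

lemma ContDiff.tangentCoord {n : WithTop ℕ∞} (hv : ContDiff ℝ n v) (p q : ℂ[X]) :
    ContDiff ℝ n (fun z => tangentCoord (p.eval z) (q.eval z) (v z)) := by
  have hv' (i : Fin 3) : ContDiff ℝ n (fun z => (v z i : ℂ)) :=
    ofRealCLM.contDiff.comp (contDiff_pi.1 hv i)
  have hp := p.contDiff_real (n := n)
  have hq := q.contDiff_real (n := n)
  unfold _root_.tangentCoord
  fun_prop

/-- The Cauchy-Riemann operator applied to the homogeneous coordinate of a tangent field. -/
lemma cauchyRiemann_tangentCoord (p q : ℂ[X]) (hv : ContDiff ℝ 1 v) (z : ℂ) :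
    fderiv ℝ (fun z => tangentCoord (p.eval z) (q.eval z) (v z)) z 1
      + I * fderiv ℝ (fun z => tangentCoord (p.eval z) (q.eval z) (v z)) z I
      = tangentCoord (p.eval z) (q.eval z) (dx v z)
        + I * tangentCoord (p.eval z) (q.eval z) (dy v z) := by
  -- `tangentCoord` involves a and b without conjugates, so differentiating p and q contributes a
  -- term complex linear in e, which the Cauchy-Riemann operator kills.
  have key (e : ℂ) : fderiv ℝ (fun z => tangentCoord (p.eval z) (q.eval z) (v z)) z e
      = tangentCoord (p.eval z) (q.eval z) (fderiv ℝ v z e)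
        + (p.eval z * p.derivative.eval z * (v z 0 + v z 1 * I)
          + (p.derivative.eval z * q.eval z + p.eval z * q.derivative.eval z) * v z 2
          - q.eval z * q.derivative.eval z * (v z 0 - v z 1 * I)) * e := by
    apply fderiv_apply_of_hasDerivAt_line
      ((hv.tangentCoord p q).differentiable one_ne_zero z)
    have hv0 : HasDerivAt (fun t : ℝ => v (z + t * e)) (fderiv ℝ v z e) 0 :=
      (hv.differentiable one_ne_zero z).hasFDerivAt.comp_hasDerivAt_of_eq (0 : ℝ)
        (hasDerivAt_add_mul z e 0) (by simp)
    have hv1 (i : Fin 3) : HasDerivAt (fun t : ℝ => (v (z + t * e) i : ℂ))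
        (fderiv ℝ v z e i : ℝ) 0 := ((hasDerivAt_pi.1 hv0) i).ofReal_comp
    have hp := p.hasDerivAt_line z e
    have hq := q.hasDerivAt_line z e
    have := ((((hp.pow 2).mul ((hv1 0).add ((hv1 1).mul_const I))).add
      (((hp.const_mul 2).mul hq).mul (hv1 2))).sub
      ((hq.pow 2).mul ((hv1 0).sub ((hv1 1).mul_const I)))).div_const 2
    refine this.congr_deriv ?_
    simp [tangentCoord]
    ring
  rw [key, key]
  unfold dx dy
  linear_combination (p.eval z * p.derivative.eval z * (v z 0 + v z 1 * I)
          + (p.derivative.eval z * q.eval z + p.eval z * q.derivative.eval z) * v z 2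
          - q.eval z * q.derivative.eval z * (v z 0 - v z 1 * I)) * I_mul_I

/-- The term v × u_y is a product of two tangent vectors, hence normal and invisible to the
coordinate; u × v_y contributes -i times the coordinate of v_y. -/
lemma IsCoprime.tangentCoord_L1 (hpq : IsCoprime p q) {z : ℂ}
    (hv : ratSphere p q z ⬝ᵥ v z = 0) :
    tangentCoord (p.eval z) (q.eval z) (L1 (ratSphere p q) v z)
      = tangentCoord (p.eval z) (q.eval z) (dx v z)
        + I * tangentCoord (p.eval z) (q.eval z) (dy v z) := by
  have hD := (hpq.homDen_pos z).ne'
  have h1 : tangentCoord (p.eval z) (q.eval z) (v z ⨯₃ dy (ratSphere p q) z) = 0 := by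
    rw [hpq.dy_ratSphere, hpq.ratSphere_eq] at *
    rw [cross_eq_smul_of_dot_eq_zero (sphereHom_dot_self hD) hv
      (sphereHom_dot_sphereTangent _ _ _), tangentCoord_smul_sphereHom]
  rw [L1, tangentCoord_sub, tangentCoord_sub, h1]
  rw [hpq.ratSphere_eq, tangentCoord_sphereHom_cross hD]
  ring

/-- Differentiate u·v = 0 in x and use u·(v × u_y) = -v·(u × u_y) = -v·u_x. Being tangent, L₁[v] is
then determined by its homogeneous coordinate. -/
lemma IsCoprime.dot_L1 (hpq : IsCoprime p q) (hv : ContDiff ℝ 1 v)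
    (hv0 : ∀ z, ratSphere p q z ⬝ᵥ v z = 0) (z : ℂ) :
    ratSphere p q z ⬝ᵥ L1 (ratSphere p q) v z = 0 := by
  have h1 : HasDerivAt (fun t : ℝ => v (z + t * 1)) (dx v z) 0 :=
    (hv.differentiable one_ne_zero z).hasFDerivAt.comp_hasDerivAt_of_eq (0 : ℝ)
      (hasDerivAt_add_mul z 1 0) (by simp)
  have h2 : HasDerivAt (fun t : ℝ => ratSphere p q (z + t * 1)) (dx (ratSphere p q) z) 0 :=
    (hpq.contDiff_ratSphere.differentiable one_ne_zero z).hasFDerivAt.comp_hasDerivAt_of_eq (0 : ℝ)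
      (hasDerivAt_add_mul z 1 0) (by simp)
  have h3 : HasDerivAt (fun t : ℝ => ratSphere p q (z + t * 1) ⬝ᵥ v (z + t * 1))
      (dx (ratSphere p q) z ⬝ᵥ v z + ratSphere p q z ⬝ᵥ dx v z) 0 := by
    have := HasDerivAt.fun_sum (u := Finset.univ)
      fun i _ => ((hasDerivAt_pi.1 h2) i).mul ((hasDerivAt_pi.1 h1) i)
    simpa [dotProduct, Finset.sum_add_distrib] using this
  simp only [hv0] at h3
  have h4 := h3.unique (hasDerivAt_const _ _)
  rw [L1, dotProduct_sub, dotProduct_sub, dot_self_cross, sub_zero,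
    triple_product_permutation, ← cross_anticomm, ← hpq.dx_eq_cross_dy, dotProduct_neg,
    dotProduct_comm]
  rw [dotProduct_comm (v z)]
  rw [dotProduct_comm (dx v z)]
  linarith

/-- The linearized equation holds exactly when the homogeneous coordinate is holomorphic. -/
lemma IsCoprime.L1_eq_zero_iff (hpq : IsCoprime p q) (hv : ContDiff ℝ 1 v)
    (hv0 : ∀ z, ratSphere p q z ⬝ᵥ v z = 0) (z : ℂ) :
    L1 (ratSphere p q) v z = 0 ↔
      DifferentiableAt ℂ (fun z => tangentCoord (p.eval z) (q.eval z) (v z)) z := by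
  have hdiff := (hv.tangentCoord p q).differentiable one_ne_zero z
  rw [differentiableAt_complex_iff_differentiableAt_real, and_iff_right hdiff]
  have h1 := cauchyRiemann_tangentCoord p q hv z
  rw [← hpq.tangentCoord_L1 (hv0 z)] at h1
  have h2 : L1 (ratSphere p q) v z = 0 ↔
      tangentCoord (p.eval z) (q.eval z) (L1 (ratSphere p q) v z) = 0 := by
    refine ⟨fun h => by rw [h]; simp [tangentCoord], fun h => ?_⟩
    have h3 := hpq.dot_L1 hv hv0 z
    rw [← sphereTangent_tangentCoord (v := L1 (ratSphere p q) v z) (hpq.homDen_pos z).ne'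
      (by rwa [← ratSphere_eq_sphereHom (hpq.eval_ne_zero_or z)]), h]
    rw [sphereTangent_expand]
    simp
  rw [h2, ← h1, smul_eq_mul]
  constructor
  · intro h
    linear_combination (-I) * h + (fderiv ℝ (fun z => tangentCoord (p.eval z) (q.eval z) (v z)) z I)
      * I_mul_I
  · intro h
    rw [h]
    linear_combination
      (fderiv ℝ (fun z => tangentCoord (p.eval z) (q.eval z) (v z)) z 1) * I_mul_I

end

/-! ### Growth at infinity: polynomials, the lower bound for |p|² + |q|², Liouville. -/

section

open Filter Bornology Topology

/-- The exponent may exceed the degree, the limit then being 0, so p and q can share the exponent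
`ratDegree p q`. -/
lemma Polynomial.tendsto_eval_div_pow (P : ℂ[X]) {d : ℕ} (hP : P.natDegree ≤ d) :
    Tendsto (fun z => P.eval z / z ^ d) (cobounded ℂ) (𝓝 (P.coeff d)) := by
  have h : ∀ᶠ z : ℂ in cobounded ℂ,
      ∑ i ∈ Finset.range (d + 1), P.coeff i * (z⁻¹) ^ (d - i) = P.eval z / z ^ d := by
    filter_upwards [eventually_ne_cobounded (0 : ℂ)] with z hz
    rw [eval_eq_sum_range' (Nat.lt_succ_of_le hP), Finset.sum_div]
    refine Finset.sum_congr rfl fun i hi => ?_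
    have hi' : i ≤ d := Nat.lt_succ_iff.1 (Finset.mem_range.1 hi)
    rw [inv_pow, mul_div_assoc, ← Nat.sub_add_cancel hi', pow_add, Nat.add_sub_cancel]
    field_simp
  refine Tendsto.congr' h ?_
  have h2 : P.coeff d = ∑ i ∈ Finset.range (d + 1), P.coeff i * (0 : ℂ) ^ (d - i) := by
    rw [Finset.sum_range_succ, Finset.sum_eq_zero]
    · simp
    · intro i hi
      rw [zero_pow (by have := Finset.mem_range.1 hi; omega), mul_zero]
  rw [h2]
  exact tendsto_finsetSum _ fun i _ => (tendsto_inv₀_cobounded.pow _).const_mul _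

/-- The degree of the rational function `q / p`. -/
def ratDegree (p q : ℂ[X]) : ℕ := max p.natDegree q.natDegree

lemma homDen_coeff_ratDegree_pos {p q : ℂ[X]} (hp : p ≠ 0) :
    0 < homDen (p.coeff (ratDegree p q)) (q.coeff (ratDegree p q)) := by
  apply homDen_pos
  unfold ratDegree
  rcases le_total q.natDegree p.natDegree with h | h
  · left
    rw [max_eq_left h]
    simpa using hp
  · rw [max_eq_right h]
    by_cases hq : q = 0
    · left
      subst hq
      have : p.natDegree = 0 := by simpa using h
      simpa [← this] using hp
    · right
      simpa using hq

lemma homDen_div (a b c : ℂ) : homDen (a / c) (b / c) = homDen a b / ‖c‖ ^ 2 := by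
  simp only [homDen, map_div₀, normSq_eq_norm_sq]
  ring

/-- Near infinity the quotient by |z|^(2d) has a positive limit, since p or q attains degree d; on
the remaining disc a positive continuous function has a positive minimum. -/
lemma IsCoprime.exists_le_homDen {p q : ℂ[X]} (hpq : IsCoprime p q) (hp : p ≠ 0) :
    ∃ c > 0, ∀ z : ℂ, c * (1 + ‖z‖) ^ (2 * ratDegree p q) ≤ homDen (p.eval z) (q.eval z) := by
  set d := ratDegree p q with hd
  set L := homDen (p.coeff d) (q.coeff d) with hL
  have hLpos : 0 < L := homDen_coeff_ratDegree_pos hp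
  have hcont : Continuous fun z => homDen (p.eval z) (q.eval z) :=
    (p.contDiff_real.homDen q.contDiff_real (n := 0)).continuous
  have ht : Tendsto (fun z => homDen (p.eval z / z ^ d) (q.eval z / z ^ d)) (cobounded ℂ)
      (𝓝 L) :=
    ((continuous_normSq.tendsto _).comp (p.tendsto_eval_div_pow (le_max_left _ _))).add
      ((continuous_normSq.tendsto _).comp (q.tendsto_eval_div_pow (le_max_right _ _)))
  have hev := (ht.eventually (lt_mem_nhds (half_lt_self hLpos))).and
    (eventually_cobounded_le_norm (1 : ℝ))
  obtain ⟨R, -, hR⟩ := (hasBasis_cobounded_norm (E := ℂ)).eventually_iff.1 hev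
  obtain ⟨z₀, -, hz₀⟩ := (isCompact_closedBall (0 : ℂ) |R|).exists_isMinOn
    ⟨0, by simp⟩ hcont.continuousOn
  have hm := hpq.homDen_pos z₀
  set μ := homDen (p.eval z₀) (q.eval z₀) with hμ
  refine ⟨min (μ / (1 + |R|) ^ (2 * d)) (L / 2 / 2 ^ (2 * d)), by positivity, fun z => ?_⟩
  rcases le_or_gt ‖z‖ |R| with hz | hz
  · calc _ ≤ μ / (1 + |R|) ^ (2 * d) * (1 + |R|) ^ (2 * d) := by
          gcongr
          exact min_le_left _ _
      _ = μ := by field_simp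
      _ ≤ _ := hz₀ (by simpa using hz)
  · obtain ⟨h1, h2⟩ := hR (show R ≤ ‖z‖ from (le_abs_self R).trans hz.le)
    rw [homDen_div, norm_pow, lt_div_iff₀ (by positivity)] at h1
    calc _ ≤ L / 2 / 2 ^ (2 * d) * (2 * ‖z‖) ^ (2 * d) := by
          gcongr
          · exact min_le_right _ _
          · linarith
      _ = L / 2 * (‖z‖ ^ d) ^ 2 := by
          rw [mul_pow, ← pow_mul, mul_comm d 2]
          field_simp
      _ ≤ _ := h1.le

/-- An entire function of polynomial growth is a polynomial. -/
lemma Differentiable.exists_polynomial_of_norm_le (n : ℕ) : ∀ {f : ℂ → ℂ},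
    Differentiable ℂ f → ∀ {K : ℝ}, (∀ z, ‖f z‖ ≤ K * (1 + ‖z‖) ^ n) →
    ∃ P : ℂ[X], P.natDegree ≤ n ∧ ∀ z, f z = P.eval z := by
  induction n with
  | zero =>
    intro f hf K hK
    refine ⟨C (f 0), by simp, fun z => ?_⟩
    rw [eval_C]
    refine hf.apply_eq_apply_of_bounded ?_ z 0
    rw [isBounded_iff_forall_norm_le]
    exact ⟨K, by rintro _ ⟨z, rfl⟩; simpa using hK z⟩
  | succ n ih =>
    intro f hf K hK
    have hK0 : 0 ≤ K := by simpa using (norm_nonneg _).trans (hK 0)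
    -- The quotient (f(z) - f(0))/z is entire and grows one power more slowly. For |z| > 1 the
    -- factor 4 is 2 from the subtraction times 2 from 1 + |z| ≤ 2|z|.
    have hg : Differentiable ℂ (dslope f 0) := fun z =>
      ((differentiableOn_dslope (c := (0 : ℂ)) (s := Set.univ) Filter.univ_mem).2
        hf.differentiableOn).differentiableAt Filter.univ_mem
    obtain ⟨B, hB⟩ := (isCompact_closedBall (0 : ℂ) 1).exists_bound_of_continuousOn
      hg.continuous.continuousOn
    obtain ⟨P, hP, hPf⟩ := ih hg (K := max B (4 * K)) (fun z => by
      rcases le_or_gt ‖z‖ 1 with hz | hz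
      · calc _ ≤ B := hB z (by simpa using hz)
          _ ≤ max B (4 * K) * 1 := by rw [mul_one]; exact le_max_left _ _
          _ ≤ _ := by
            gcongr
            exact one_le_pow₀ (by linarith [norm_nonneg z])
      · have hz0 : z ≠ 0 := norm_pos_iff.1 (zero_lt_one.trans hz)
        rw [dslope_of_ne _ hz0, slope_def_field, sub_zero, norm_div, div_le_iff₀ (by positivity)]
        have h0 : ‖f 0‖ ≤ K := by simpa using hK 0
        calc ‖f z - f 0‖ ≤ K * (1 + ‖z‖) ^ (n + 1) + K * 1 := by
              refine (norm_sub_le _ _).trans (add_le_add (hK z) (by simpa using h0))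
          _ ≤ K * (1 + ‖z‖) ^ (n + 1) + K * (1 + ‖z‖) ^ (n + 1) := by
              gcongr
              exact one_le_pow₀ (by linarith [norm_nonneg z])
          _ = 2 * K * (1 + ‖z‖) ^ n * (1 + ‖z‖) := by ring
          _ ≤ 2 * K * (1 + ‖z‖) ^ n * (2 * ‖z‖) := by gcongr; linarith
          _ = 4 * K * (1 + ‖z‖) ^ n * ‖z‖ := by ring
          _ ≤ _ := by gcongr; exact le_max_right _ _)
    refine ⟨X * P + C (f 0), ?_, fun z => ?_⟩
    · refine (natDegree_add_C).le.trans (natDegree_mul_le.trans ?_)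
      rw [natDegree_X]
      omega
    · rw [eval_add, eval_mul, eval_X, eval_C, ← hPf]
      have := sub_smul_dslope f 0 z
      rw [sub_zero, smul_eq_mul] at this
      rw [this]
      ring

/-! ### Calculus of maps whose derivatives obey a common power bound. -/

section SymbolGrowth

variable {F G : Type*} [NormedAddCommGroup F] [NormedSpace ℝ F]
  [NormedAddCommGroup G] [NormedSpace ℝ G]

/-- A smooth map whose derivatives up to order `n` are `O((1 + |z|)ˢ)`. -/
def SymbolGrowth (n : ℕ) (s : ℤ) (f : ℂ → F) : Prop :=
  ContDiff ℝ n f ∧ ∀ k ≤ n, ∃ K : ℝ, ∀ z, ‖iteratedFDeriv ℝ k f z‖ ≤ K * (1 + ‖z‖) ^ s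

namespace SymbolGrowth

variable {n : ℕ} {s t : ℤ} {f g : ℂ → F}

lemma mono (hf : SymbolGrowth n s f) (h : s ≤ t) : SymbolGrowth n t f := by
  refine ⟨hf.1, fun k hk => ?_⟩
  obtain ⟨K, hK⟩ := hf.2 k hk
  refine ⟨|K|, fun z => (hK z).trans ?_⟩
  have : 1 ≤ 1 + ‖z‖ := by linarith [norm_nonneg z]
  gcongr
  · exact le_abs_self K

lemma of_le {m : ℕ} (hf : SymbolGrowth n s f) (h : m ≤ n) : SymbolGrowth m s f :=
  ⟨hf.1.of_le (mod_cast h), fun k hk => hf.2 k (hk.trans h)⟩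

lemma zero_iff : SymbolGrowth 0 s f ↔
    Continuous f ∧ ∃ K : ℝ, ∀ z, ‖f z‖ ≤ K * (1 + ‖z‖) ^ s := by
  simp [SymbolGrowth, contDiff_zero]

/-- The exponent is not required to drop under differentiation, so the class is recursive in n and
derivatives can be peeled off one at a time. -/
lemma succ_iff : SymbolGrowth (n + 1) s f ↔ Differentiable ℝ f ∧
    (∃ K : ℝ, ∀ z, ‖f z‖ ≤ K * (1 + ‖z‖) ^ s) ∧ SymbolGrowth n s (fderiv ℝ f) := by
  have h1 : ContDiff ℝ (n + 1 : ℕ) f ↔ Differentiable ℝ f ∧ ContDiff ℝ n (fderiv ℝ f) := by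
    rw [Nat.cast_add, Nat.cast_one, contDiff_succ_iff_fderiv]
    simp
  unfold SymbolGrowth
  rw [h1]
  constructor
  · rintro ⟨⟨hd, hc⟩, hb⟩
    refine ⟨hd, by simpa using hb 0 (by omega), hc, fun k hk => ?_⟩
    simpa [norm_iteratedFDeriv_fderiv] using hb (k + 1) (by omega)
  · rintro ⟨hd, hb0, hc, hb⟩
    refine ⟨⟨hd, hc⟩, fun k hk => ?_⟩
    rcases k with _ | k
    · simpa using hb0
    · simpa [norm_iteratedFDeriv_fderiv] using hb k (by omega)

lemma add (hf : SymbolGrowth n s f) (hg : SymbolGrowth n s g) :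
    SymbolGrowth n s (fun z => f z + g z) := by
  refine ⟨hf.1.add hg.1, fun k hk => ?_⟩
  obtain ⟨K, hK⟩ := hf.2 k hk
  obtain ⟨M, hM⟩ := hg.2 k hk
  refine ⟨K + M, fun z => ?_⟩
  rw [show (fun z => f z + g z) = f + g from rfl, iteratedFDeriv_add_apply
    (hf.1.of_le (mod_cast hk)).contDiffAt (hg.1.of_le (mod_cast hk)).contDiffAt, add_mul]
  exact (norm_add_le _ _).trans (add_le_add (hK z) (hM z))

lemma clm_comp (L : F →L[ℝ] G) (hf : SymbolGrowth n s f) :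
    SymbolGrowth n s (fun z => L (f z)) := by
  refine ⟨L.contDiff.comp hf.1, fun k hk => ?_⟩
  obtain ⟨K, hK⟩ := hf.2 k hk
  refine ⟨‖L‖ * K, fun z => ?_⟩
  rw [mul_assoc]
  exact (L.norm_iteratedFDeriv_comp_left (n := k)
    (hf.1.of_le (mod_cast hk)).contDiffAt le_rfl).trans
    (mul_le_mul_of_nonneg_left (hK z) (norm_nonneg _))

lemma const (c : F) : SymbolGrowth n 0 (fun _ : ℂ => c) := by
  induction n generalizing F with
  | zero => exact zero_iff.2 ⟨continuous_const, ‖c‖, by simp⟩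
  | succ n ih =>
    refine succ_iff.2 ⟨differentiable_const c, ⟨‖c‖, by simp⟩, ?_⟩
    simpa using! ih (0 : ℂ →L[ℝ] F)

lemma neg (hf : SymbolGrowth n s f) : SymbolGrowth n s (fun z => -f z) :=
  hf.clm_comp (-ContinuousLinearMap.id ℝ F)

lemma sub (hf : SymbolGrowth n s f) (hg : SymbolGrowth n s g) :
    SymbolGrowth n s (fun z => f z - g z) := by
  simpa only [sub_eq_add_neg] using hf.add hg.neg

lemma sum {ι : Type*} (S : Finset ι) {φ : ι → ℂ → F} (h : ∀ i ∈ S, SymbolGrowth n s (φ i))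
    (hs : 0 ≤ s) : SymbolGrowth n s (fun z => ∑ i ∈ S, φ i z) := by
  classical
  induction S using Finset.induction_on with
  | empty => simpa using (const (0 : F)).mono hs
  | insert i S hi ih =>
    simp only [Finset.sum_insert hi]
    exact (h i (by simp)).add (ih fun j hj => h j (by simp [hj]))

lemma id : SymbolGrowth n 1 (fun z : ℂ => z) := by
  have h0 : ∃ K : ℝ, ∀ z : ℂ, ‖z‖ ≤ K * (1 + ‖z‖) ^ (1 : ℤ) := ⟨1, by simp⟩
  rcases n with _ | n
  · exact zero_iff.2 ⟨continuous_id, h0⟩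
  · refine succ_iff.2 ⟨differentiable_id, h0, ?_⟩
    have : fderiv ℝ (fun z : ℂ => z) = fun _ => ContinuousLinearMap.id ℝ ℂ := by
      ext1 z; exact fderiv_id
    rw [this]
    exact (const _).mono zero_le_one

lemma smul [NormedSpace ℂ F] [IsScalarTower ℝ ℂ F] {c : ℂ → ℂ} (hc : SymbolGrowth n s c)
    (hf : SymbolGrowth n t f) : SymbolGrowth n (s + t) (fun z => c z • f z) := by
  refine ⟨hc.1.smul hf.1, fun k hk => ?_⟩
  have hc' := fun i : ℕ => fun hi : i ≤ k => hc.2 i (hi.trans hk)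
  have hf' := fun i : ℕ => fun hi : i ≤ k => hf.2 i (hi.trans hk)
  choose! K hK using hc'
  choose! M hM using hf'
  refine ⟨∑ i ∈ Finset.range (k + 1), (k.choose i : ℝ) * K i * M (k - i), fun z => ?_⟩
  refine (norm_iteratedFDeriv_smul_le hc.1 hf.1 z (mod_cast hk)).trans ?_
  rw [Finset.sum_mul]
  refine Finset.sum_le_sum fun i hi => ?_
  have hz : 0 < 1 + ‖z‖ := by positivity
  have hi' : i ≤ k := Nat.lt_succ_iff.1 (Finset.mem_range.1 hi)
  calc _ ≤ (k.choose i : ℝ) * (K i * (1 + ‖z‖) ^ s) * (M (k - i) * (1 + ‖z‖) ^ t) := by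
        gcongr
        · exact mul_nonneg (Nat.cast_nonneg _) ((norm_nonneg _).trans (hK i hi' z))
        · exact hK i hi' z
        · exact hM (k - i) (Nat.sub_le _ _) z
    _ = _ := by rw [zpow_add₀ hz.ne']; ring

lemma mul {f g : ℂ → ℂ} (hf : SymbolGrowth n s f) (hg : SymbolGrowth n t g) :
    SymbolGrowth n (s + t) (fun z => f z * g z) := hf.smul hg

lemma polynomial (P : ℂ[X]) {d : ℕ} (hP : P.natDegree ≤ d) :
    SymbolGrowth n d (fun z => P.eval z) := by
  have hpow (j : ℕ) : SymbolGrowth n j (fun z : ℂ => z ^ j) := by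
    induction j with
    | zero => simpa using const (n := n) (1 : ℂ)
    | succ j ih => simpa [pow_succ] using ih.mul id
  simp only [eval_eq_sum_range' (Nat.lt_succ_of_le hP)]
  refine sum _ (fun i hi => ?_) (by positivity)
  refine ((const (P.coeff i)).mul (hpow i)).mono ?_
  have := Finset.mem_range.1 hi
  omega

lemma star {f : ℂ → ℂ} (hf : SymbolGrowth n s f) : SymbolGrowth n s (fun z => conj (f z)) :=
  hf.clm_comp conjCLE.toContinuousLinearMap

/-- Induction on n through (1/f)' = -f'/f²: the exponents add up to -s - s + s = -s. -/
lemma inv {f : ℂ → ℂ} (hf : SymbolGrowth n s f) {c : ℝ} (hc : 0 < c)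
    (h : ∀ z, c * (1 + ‖z‖) ^ s ≤ ‖f z‖) : SymbolGrowth n (-s) (fun z => (f z)⁻¹) := by
  have hne (z : ℂ) : f z ≠ 0 := by
    rw [← norm_pos_iff]
    exact lt_of_lt_of_le (by positivity) (h z)
  have hb : ∃ K : ℝ, ∀ z, ‖(f z)⁻¹‖ ≤ K * (1 + ‖z‖) ^ (-s) := by
    refine ⟨c⁻¹, fun z => ?_⟩
    rw [norm_inv, _root_.zpow_neg, ← mul_inv]
    exact inv_anti₀ (by positivity) (h z)
  induction n with
  | zero => exact zero_iff.2 ⟨(zero_iff.1 hf).1.inv₀ hne, hb⟩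
  | succ n ih =>
    have ih' := ih (hf.of_le n.le_succ)
    obtain ⟨hd, -, hf'⟩ := succ_iff.1 hf
    refine succ_iff.2 ⟨hd.inv hne, hb, ?_⟩
    have : fderiv ℝ (fun z => (f z)⁻¹) = fun z => -(((f z)⁻¹ * (f z)⁻¹) • fderiv ℝ f z) := by
      ext1 z
      have h1 := ((hasDerivAt_inv (hne z)).hasFDerivAt.restrictScalars ℝ).comp z
        (hd z).hasFDerivAt
      refine h1.fderiv.trans ?_
      ext e
      simp
      ring
    rw [this]
    refine (((ih'.mul ih').smul hf').neg).mono (by omega)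

end SymbolGrowth

end SymbolGrowth

end

/-! ### The degree of 𝒮(q/p), by Stokes on large discs. -/

section

open Filter Bornology Topology Set

/-- Integration over a disc in polar coordinates. -/
lemma Complex.setIntegral_closedBall_eq_polar {f : ℂ → ℝ} (hf : Continuous f) {R : ℝ}
    (hR : 0 ≤ R) :
    ∫ z in Metric.closedBall 0 R, f z
      = ∫ r in 0..R, ∫ θ in -Real.pi..Real.pi, r * f (r * exp (θ * I)) := by
  have hexp (x : ℝ × ℝ) : Complex.polarCoord.symm x = x.1 * exp (x.2 * I) := by
    rw [Complex.polarCoord_symm_apply, exp_mul_I]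
    push_cast
    rfl
  rw [← integral_indicator Metric.isClosed_closedBall.measurableSet,
    ← Complex.integral_comp_polarCoord_symm]
  have h1 : (fun x : ℝ × ℝ => x.1 • (Metric.closedBall 0 R).indicator f
        (Complex.polarCoord.symm x))
      = {x : ℝ × ℝ | |x.1| ≤ R}.indicator (fun x => x.1 * f (x.1 * exp (x.2 * I))) := by
    ext x
    by_cases hx : |x.1| ≤ R
    · rw [indicator_of_mem (by simpa using hx), indicator_of_mem (show x ∈ {x : ℝ × ℝ | |x.1| ≤ R} from hx), hexp, smul_eq_mul]
    · rw [indicator_of_notMem (by simpa using hx),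
        indicator_of_notMem (show x ∉ {x : ℝ × ℝ | |x.1| ≤ R} from hx), smul_zero]
  have h2 : polarCoord.target ∩ {x : ℝ × ℝ | |x.1| ≤ R}
      = Ioc 0 R ×ˢ Ioo (-Real.pi) Real.pi := by
    ext x
    simp only [polarCoord_target, mem_inter_iff, mem_prod, mem_Ioi, mem_Ioo, mem_ofPred_eq, mem_Ioc]
    constructor
    · rintro ⟨⟨h1, h2⟩, h3⟩
      exact ⟨⟨h1, (le_abs_self _).trans h3⟩, h2⟩
    · rintro ⟨⟨h1, h3⟩, h2⟩
      exact ⟨⟨h1, h2⟩, by rwa [abs_of_pos h1]⟩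
  rw [h1, setIntegral_indicator (isClosed_le (by fun_prop) (by fun_prop)).measurableSet, h2,
    Measure.volume_eq_prod, setIntegral_prod]
  · rw [intervalIntegral.integral_of_le hR]
    refine integral_congr_ae (.of_forall fun r => ?_)
    simp only
    rw [intervalIntegral.integral_of_le (by linarith [Real.pi_pos]), integral_Ioc_eq_integral_Ioo]
  · refine IntegrableOn.mono_set (t := Icc 0 R ×ˢ Icc (-Real.pi) Real.pi) ?_
      (prod_mono Ioc_subset_Icc_self Ioo_subset_Icc_self)
    exact ContinuousOn.integrableOn_compact (isCompact_Icc.prod isCompact_Icc)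
      (Continuous.continuousOn (by fun_prop))

/-- The complex Stokes formula on a disc, in polar coordinates: if `B = ∂K/∂z̄`, then the integral of
`B` over the disc is a boundary integral of `K`. -/
lemma integral_polar_dbar {K A B : ℂ → ℂ} (hK : ContDiff ℝ 1 K) (hB : Continuous B)
    (hd : ∀ z e, fderiv ℝ K z e = A z * e + B z * conj e) (R : ℝ) :
    ∫ r in 0..R, ∫ θ in -Real.pi..Real.pi, 2 * r * B (r * exp (θ * I))
      = ∫ θ in -Real.pi..Real.pi, R * exp (θ * I) * K (R * exp (θ * I)) := by
  -- The pair (f, g) has divergence 2rB in (r, θ): the K and A terms of the two derivatives cancel.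
  -- On the boundary of the rectangle the sides θ = ±π cancel by periodicity and f vanishes at r =
  -- 0.
  set f : ℝ × ℝ → ℂ := fun x => x.1 * exp (x.2 * I) * K (x.1 * exp (x.2 * I)) with hf
  set g : ℝ × ℝ → ℂ := fun x => I * exp (x.2 * I) * K (x.1 * exp (x.2 * I)) with hg
  have hre : ContDiff ℝ 1 (fun x : ℝ × ℝ => (x.1 : ℂ)) := ofRealCLM.contDiff.comp contDiff_fst
  have him : ContDiff ℝ 1 (fun x : ℝ × ℝ => (x.2 : ℂ)) := ofRealCLM.contDiff.comp contDiff_snd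
  have hexp : ContDiff ℝ 1 (fun x : ℝ × ℝ => exp (x.2 * I)) := by fun_prop
  have hKc : ContDiff ℝ 1 (fun x : ℝ × ℝ => K (x.1 * exp (x.2 * I))) := hK.comp (hre.mul hexp)
  have hfc : ContDiff ℝ 1 f := (hre.mul hexp).mul hKc
  have hgc : ContDiff ℝ 1 g := (contDiff_const.mul hexp).mul hKc
  have hconj (θ : ℝ) : conj (exp (θ * I)) * exp (θ * I) = 1 := by
    rw [← exp_conj, ← exp_add]
    simp
  have hline {γ : ℝ → ℂ} {e : ℂ} {t : ℝ} (h : HasDerivAt γ e t) :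
      HasDerivAt (fun s => K (γ s)) (A (γ t) * e + B (γ t) * conj e) t := by
    rw [← hd]
    exact (hK.differentiable one_ne_zero _).hasFDerivAt.comp_hasDerivAt t h
  have key (x : ℝ × ℝ) : fderiv ℝ f x (1, 0) + fderiv ℝ g x (0, 1)
      = 2 * x.1 * B (x.1 * exp (x.2 * I)) := by
    obtain ⟨r, θ⟩ := x
    have hr : HasDerivAt (fun s : ℝ => (s : ℂ) * exp (θ * I)) (exp (θ * I)) r := by
      simpa using (hasDerivAt_id r).ofReal_comp.mul_const (exp (θ * I))
    have hE : HasDerivAt (fun s : ℝ => exp (s * I)) (exp (θ * I) * I) θ := by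
      have := ((hasDerivAt_id θ).ofReal_comp.mul_const I).cexp
      simpa using this
    have h1 : HasDerivAt (fun s : ℝ => f (s, θ)) (fderiv ℝ f (r, θ) (1, 0)) r :=
      (hfc.differentiable one_ne_zero _).hasFDerivAt.comp_hasDerivAt r
        ((hasDerivAt_id r).prodMk (hasDerivAt_const r θ))
    have h2 : HasDerivAt (fun s : ℝ => g (r, s)) (fderiv ℝ g (r, θ) (0, 1)) θ :=
      (hgc.differentiable one_ne_zero _).hasFDerivAt.comp_hasDerivAt θ
        ((hasDerivAt_const θ r).prodMk (hasDerivAt_id θ))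
    have h3 := hr.mul (hline hr)
    have h4 := (hE.const_mul I).mul (hline (hE.const_mul (r : ℂ)))
    rw [h1.unique h3, h2.unique h4]
    simp only [map_mul, conj_ofReal, conj_I]
    linear_combination (2 * r * B (r * exp (θ * I))) * hconj θ
      + (exp (θ * I) * K (r * exp (θ * I)) + exp (θ * I) ^ 2 * A (r * exp (θ * I)) * r
        - r * B (r * exp (θ * I)) * conj (exp (θ * I)) * exp (θ * I)) * I_mul_I
  have hdiv := integral2_divergence_prod_of_hasFDerivAt_off_countable f g (fderiv ℝ f) (fderiv ℝ g)
    0 (-Real.pi) R Real.pi ∅ countable_empty hfc.continuous.continuousOn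
    hgc.continuous.continuousOn
    (fun x _ => (hfc.differentiable one_ne_zero x).hasFDerivAt)
    (fun x _ => (hgc.differentiable one_ne_zero x).hasFDerivAt) (by
      simp only [key]
      exact ContinuousOn.integrableOn_compact (isCompact_uIcc.prod isCompact_uIcc)
        (Continuous.continuousOn (by fun_prop)))
  simp only [key] at hdiv
  rw [hdiv]
  have hper : exp ((Real.pi : ℝ) * I) = exp ((-Real.pi : ℝ) * I) := by
    simp [exp_neg]
  simp [hf, hg, hper]

section Degree

variable {p q : ℂ[X]}

/-- The integral of the Jacobian of `q / p` for the round metric. -/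
lemma IsCoprime.integral_wronsk (hpq : IsCoprime p q) (hp : p ≠ 0) :
    ∫ z, normSq ((wronsk p q).eval z) / homDen (p.eval z) (q.eval z) ^ 2
      = Real.pi * ratDegree p q := by
  set d := ratDegree p q with hd
  set D : ℂ → ℝ := fun z => homDen (p.eval z) (q.eval z) with hD
  have hDpos (z) : 0 < D z := hpq.homDen_pos z
  have hDne (z) : (D z : ℂ) ≠ 0 := ofReal_ne_zero.2 (hDpos z).ne'
  have hDe (z) : (D z : ℂ) = p.eval z * conj (p.eval z) + q.eval z * conj (q.eval z) := by
    change ((homDen (p.eval z) (q.eval z) : ℝ) : ℂ) = _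
    rw [homDen, mul_conj, mul_conj, ofReal_add]
  have hDc {n : WithTop ℕ∞} : ContDiff ℝ n (fun z => (D z : ℂ)) :=
    ofRealCLM.contDiff.comp (p.contDiff_real.homDen q.contDiff_real)
  -- N is ∂D, so N/D = ∂ log D, and its ∂̄-derivative is the integrand B.
  set N : ℂ → ℂ := fun z => conj (p.eval z) * p.derivative.eval z
    + conj (q.eval z) * q.derivative.eval z with hN
  have hcc (P : ℂ[X]) {n : WithTop ℕ∞} : ContDiff ℝ n (fun z => conj (P.eval z)) :=
    conjCLE.contDiff.comp P.contDiff_real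
  have hNc {n : WithTop ℕ∞} : ContDiff ℝ n N :=
    ((hcc p).mul p.derivative.contDiff_real).add ((hcc q).mul q.derivative.contDiff_real)
  set B : ℂ → ℝ := fun z => normSq ((wronsk p q).eval z) / D z ^ 2 with hB
  have hBc : Continuous B :=
    (continuous_normSq.comp (wronsk p q).continuous).div
      ((p.contDiff_real.homDen q.contDiff_real (n := 0)).continuous.pow 2)
      fun z => (pow_pos (hDpos z) 2).ne'
  have hKc : ContDiff ℝ 1 (fun z => N z / D z) := by
    simp only [div_eq_mul_inv]
    exact hNc.mul (hDc.inv hDne)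
  have hfd (z e : ℂ) : fderiv ℝ (fun z => N z / D z) z e
      = ((conj (p.eval z) * p.derivative.derivative.eval z
          + conj (q.eval z) * q.derivative.derivative.eval z) / D z - N z ^ 2 / D z ^ 2) * e
        + (B z : ℂ) * conj e := by
    apply fderiv_apply_of_hasDerivAt_line (hKc.differentiable one_ne_zero z)
    have hc (P : ℂ[X]) : HasDerivAt (fun t : ℝ => conj (P.eval (z + t * e)))
        (conj (P.derivative.eval z * e)) 0 :=
      conjCLE.toContinuousLinearMap.hasFDerivAt.comp_hasDerivAt (0 : ℝ) (P.hasDerivAt_line z e)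
    have h1 := ((hc p).mul (p.derivative.hasDerivAt_line z e)).add
      ((hc q).mul (q.derivative.hasDerivAt_line z e))
    have h2 := ((p.hasDerivAt_line z e).mul (hc p)).add ((q.hasDerivAt_line z e).mul (hc q))
    have h2' : HasDerivAt (fun t : ℝ => (D (z + t * e) : ℂ)) _ 0 :=
      h2.congr_of_eventuallyEq (.of_forall fun t => hDe _)
    refine (h1.div h2' (hDne _)).congr_deriv ?_
    simp only [hB, ofReal_div, ofReal_pow, ← mul_conj]
    have e1 := hDe z
    have e2 := hDne z
    simp [hN]
    generalize (D z : ℂ) = Δ at *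
    field_simp
    rw [e1]
    ring
  -- The operator z∂ multiplies the coefficient of z^d by d, so after division by |z|^(2d) the
  -- numerator tends to d times the limit of the denominator.
  have hlim : Tendsto (fun z => z * (N z / D z)) (cobounded ℂ) (𝓝 d) := by
    have hcoeff (P : ℂ[X]) : (X * derivative P).coeff d = d * P.coeff d := by
      rcases d with _ | n
      · simp
      · rw [coeff_X_mul, coeff_derivative]
        push_cast
        ring
    have hdeg {P : ℂ[X]} (hP : P.natDegree ≤ d) :
        Tendsto (fun z => (X * derivative P).eval z / z ^ d) (cobounded ℂ)
          (𝓝 (d * P.coeff d)) := by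
      rw [← hcoeff]
      apply tendsto_eval_div_pow
      rcases Nat.eq_zero_or_pos P.natDegree with h0 | h0
      · rw [eq_C_of_natDegree_eq_zero h0]
        simp
      · refine natDegree_mul_le.trans ?_
        have := natDegree_derivative_lt h0.ne'
        rw [natDegree_X]
        omega
    have hpd : p.natDegree ≤ d := le_max_left _ _
    have hqd : q.natDegree ≤ d := le_max_right _ _
    have hL := homDen_coeff_ratDegree_pos (q := q) hp
    rw [← hd] at hL
    have hc {f : ℂ → ℂ} {c : ℂ} (hf : Tendsto f (cobounded ℂ) (𝓝 c)) :
        Tendsto (fun z => conj (f z)) (cobounded ℂ) (𝓝 (conj c)) :=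
      (continuous_conj.tendsto c).comp hf
    have tp := p.tendsto_eval_div_pow hpd
    have tq := q.tendsto_eval_div_pow hqd
    have t1 := ((hc tp).mul (hdeg hpd)).add ((hc tq).mul (hdeg hqd))
    have t2 := (tp.mul (hc tp)).add (tq.mul (hc tq))
    have hL' : p.coeff d * conj (p.coeff d) + q.coeff d * conj (q.coeff d) ≠ 0 := by
      rw [mul_conj, mul_conj, ← ofReal_add]
      exact ofReal_ne_zero.2 hL.ne'
    have t3 := t1.div t2 hL'
    have e1 : (conj (p.coeff d) * (d * p.coeff d) + conj (q.coeff d) * (d * q.coeff d))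
        / (p.coeff d * conj (p.coeff d) + q.coeff d * conj (q.coeff d)) = d := by
      rw [div_eq_iff hL']
      ring
    rw [e1] at t3
    refine t3.congr' ?_
    filter_upwards [eventually_ne_cobounded (0 : ℂ)] with z hz
    have h1 := hDne z
    have h2 : conj z ≠ 0 := by simpa using hz
    rw [hDe] at h1 ⊢
    simp only [hN, map_div₀, map_pow, eval_mul, eval_X, Pi.div_apply]
    have h3 : p.eval z / z ^ d * (conj (p.eval z) / conj z ^ d)
        + q.eval z / z ^ d * (conj (q.eval z) / conj z ^ d)
        = (p.eval z * conj (p.eval z) + q.eval z * conj (q.eval z)) / (z ^ d * conj z ^ d) := by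
      field_simp
    rw [h3]
    generalize p.eval z * conj (p.eval z) + q.eval z * conj (q.eval z) = Δ at *
    field_simp
  have hmain (R : ℝ) (hR : 0 ≤ R) :
      ((∫ z in Metric.closedBall 0 R, B z : ℝ) : ℂ) = (1 / 2) * ∫ θ in -Real.pi..Real.pi,
        R * exp (θ * I) * (N (R * exp (θ * I)) / D (R * exp (θ * I))) := by
    rw [← integral_polar_dbar hKc (continuous_ofReal.comp hBc) hfd,
      Complex.setIntegral_closedBall_eq_polar hBc hR, ← intervalIntegral.integral_ofReal,
      ← intervalIntegral.integral_const_mul]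
    refine intervalIntegral.integral_congr fun r _ => ?_
    rw [← intervalIntegral.integral_ofReal, ← intervalIntegral.integral_const_mul]
    refine intervalIntegral.integral_congr fun θ _ => ?_
    simp
    ring
  have hnorm (R θ : ℝ) : ‖(R * exp (θ * I) : ℂ)‖ = |R| := by
    rw [norm_mul, norm_exp_ofReal_mul_I, mul_one, norm_real, Real.norm_eq_abs]
  have hT (θ : ℝ) : Tendsto (fun n : ℕ => ((n : ℝ) * exp (θ * I) : ℂ)) atTop (cobounded ℂ) := by
    rw [← tendsto_norm_atTop_iff_cobounded]
    refine tendsto_natCast_atTop_atTop.congr fun n => ?_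
    rw [hnorm, abs_of_nonneg (Nat.cast_nonneg n)]
  have hconv : Tendsto (fun n : ℕ => ∫ θ in -Real.pi..Real.pi, (n : ℝ) * exp (θ * I)
      * (N ((n : ℝ) * exp (θ * I)) / D ((n : ℝ) * exp (θ * I)))) atTop
      (𝓝 (∫ _ in -Real.pi..Real.pi, (d : ℂ))) := by
    obtain ⟨R, -, hR⟩ := (hasBasis_cobounded_norm (E := ℂ)).eventually_iff.1
      (hlim.norm.eventually (gt_mem_nhds (lt_add_one _)))
    refine intervalIntegral.tendsto_integral_filter_of_dominated_convergence
      (fun _ => ‖(d : ℂ)‖ + 1) ?_ ?_ (by simp) ?_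
    · have hcont : Continuous fun z => z * (N z / D z) := continuous_id.mul hKc.continuous
      refine .of_forall fun n => Continuous.aestronglyMeasurable ?_
      exact hcont.comp (f := fun θ : ℝ => ((n : ℝ) * exp (θ * I) : ℂ)) (by fun_prop)
    · filter_upwards [tendsto_natCast_atTop_atTop.eventually_ge_atTop R] with n hn
      refine .of_forall fun θ _ => (hR (x := (n : ℝ) * exp (θ * I)) ?_).le
      change R ≤ ‖((n : ℝ) * exp (θ * I) : ℂ)‖
      rw [hnorm]
      exact hn.trans (le_abs_self _)
    · exact .of_forall fun θ _ => hlim.comp (hT θ)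
  have hBall : Tendsto (fun n : ℕ => ∫ z in Metric.closedBall 0 (n : ℝ), B z) atTop
      (𝓝 (Real.pi * d)) := by
    have h1 : Tendsto (fun n : ℕ => ((∫ z in Metric.closedBall 0 (n : ℝ), B z : ℝ) : ℂ)) atTop
        (𝓝 ((Real.pi * d : ℝ) : ℂ)) := by
      have e : ((Real.pi * d : ℝ) : ℂ)
          = (1 / 2) * ∫ _ in -Real.pi..Real.pi, (d : ℂ) := by
        rw [intervalIntegral.integral_const]
        simp
        ring
      rw [e]
      refine (hconv.const_mul (1 / 2)).congr fun n => ?_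
      rw [hmain n (Nat.cast_nonneg n)]
    simpa [Function.comp_def] using (continuous_re.tendsto _).comp h1
  -- Nonnegativity of B lets the limit over discs determine the integral over the plane without
  -- prior integrability.
  exact (aecover_closedBall tendsto_natCast_atTop_atTop).integral_eq_of_tendsto_of_nonneg_ae _
    (.of_forall fun z => div_nonneg (normSq_nonneg _) (sq_nonneg _))
    (fun n => hBc.continuousOn.integrableOn_compact (isCompact_closedBall _ _)) hBall

lemma IsCoprime.sphereDegree_ratSphere (hpq : IsCoprime p q) (hp : p ≠ 0) :
    sphereDegree (ratSphere p q) = ratDegree p q := by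
  have h (z : ℂ) : dx (ratSphere p q) z ⬝ᵥ (ratSphere p q z ⨯₃ dy (ratSphere p q) z)
      = 4 * (normSq ((wronsk p q).eval z) / homDen (p.eval z) (q.eval z) ^ 2) := by
    rw [← hpq.dx_eq_cross_dy, hpq.dx_ratSphere, sphereTangent_dot_self (hpq.homDen_pos z).ne',
      mul_div_assoc]
  simp only [sphereDegree, h]
  rw [integral_const_mul, hpq.integral_wronsk hp]
  have := Real.pi_ne_zero
  field_simp

end Degree

end

/-! ### Identification of the kernel with polynomials of degree at most 2d. -/

section

open Filter Bornology Topology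

namespace Polynomial

/-- Multiply a Bézout identity by ψ and reduce the cofactor of q modulo p. This bounds P, and then
pQ = ψ + qP has degree at most 2 deg p, which bounds Q. -/
lemma exists_mul_sub_mul_eq_of_natDegree_le {p q : ℂ[X]} (hpq : IsCoprime p q) (hp : p ≠ 0)
    (hqp : q.natDegree ≤ p.natDegree) {ψ : ℂ[X]} (hψ : ψ.natDegree ≤ 2 * p.natDegree) :
    ∃ P Q : ℂ[X], P.natDegree ≤ p.natDegree ∧ Q.natDegree ≤ p.natDegree ∧ p * Q - q * P = ψ := by
  obtain ⟨a, b, hab⟩ := hpq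
  set d := p.natDegree with hd
  have hmod : (ψ * b % p).natDegree ≤ d :=
    natDegree_le_natDegree (degree_mod_lt _ hp).le
  have heq : p * (ψ * a + q * (ψ * b / p)) - q * (-(ψ * b % p)) = ψ := by
    linear_combination ψ * hab + q * EuclideanDomain.mod_add_div (ψ * b) p
  refine ⟨-(ψ * b % p), ψ * a + q * (ψ * b / p), by rwa [natDegree_neg], ?_, heq⟩
  set Q := ψ * a + q * (ψ * b / p) with hQ
  by_cases hQ0 : Q = 0
  · simp [hQ0]
  have h1 : (p * Q).natDegree ≤ 2 * d := by
    have : p * Q = ψ - q * (ψ * b % p) := by linear_combination heq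
    rw [this]
    refine (natDegree_sub_le _ _).trans (max_le hψ (natDegree_mul_le.trans ?_))
    omega
  rw [natDegree_mul hp hQ0] at h1
  omega

lemma exists_mul_sub_mul_eq {p q : ℂ[X]} (hpq : IsCoprime p q) (hp : p ≠ 0) {ψ : ℂ[X]}
    (hψ : ψ.natDegree ≤ 2 * ratDegree p q) :
    ∃ P Q : ℂ[X], P.natDegree ≤ ratDegree p q ∧ Q.natDegree ≤ ratDegree p q ∧
      p * Q - q * P = ψ := by
  unfold ratDegree at *
  rcases le_total q.natDegree p.natDegree with h | h
  · rw [max_eq_left h] at *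
    exact exists_mul_sub_mul_eq_of_natDegree_le hpq hp h hψ
  · rw [max_eq_right h] at *
    -- Here q = 0 forces p to be constant, and the first case applies; otherwise exchange p and q,
    -- which changes the sign of ψ.
    by_cases hq : q = 0
    · subst hq
      have h0 : p.natDegree = 0 := by simpa using h
      have := exists_mul_sub_mul_eq_of_natDegree_le hpq hp h0.ge (ψ := ψ)
      simp only [h0, natDegree_zero] at *
      exact this hψ
    · obtain ⟨P, Q, hP, hQ, e⟩ := exists_mul_sub_mul_eq_of_natDegree_le hpq.symm hq h
        (ψ := -ψ) (by rwa [natDegree_neg])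
      exact ⟨Q, P, hQ, hP, by linear_combination -e⟩

end Polynomial

/-- The field along `𝒮(q/p)` with homogeneous coordinate the polynomial `ψ`. -/
def tangentField (p q : ℂ[X]) : ℂ[X] →ₗ[ℝ] (ℂ → Fin 3 → ℝ) where
  toFun ψ z := sphereTangent (p.eval z) (q.eval z) (ψ.eval z)
  map_add' ψ χ := by
    ext z i
    simp only [sphereTangent_expand, eval_add, add_re, add_im, Pi.add_apply]
    fin_cases i <;> simp <;> ring
  map_smul' c ψ := by
    ext z i
    simp only [sphereTangent_expand, eval_smul, real_smul, re_ofReal_mul, im_ofReal_mul,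
      Pi.smul_apply, RingHom.id_apply]
    fin_cases i <;> simp <;> ring

variable {p q : ℂ[X]}

lemma tangentField_apply (ψ : ℂ[X]) (z : ℂ) :
    tangentField p q ψ z = sphereTangent (p.eval z) (q.eval z) (ψ.eval z) := rfl

lemma IsCoprime.tangentField_injective (hpq : IsCoprime p q) :
    Function.Injective (tangentField p q) := by
  intro ψ χ h
  refine Polynomial.funext fun z => ?_
  have := congrArg (tangentCoord (p.eval z) (q.eval z)) (congrFun h z)
  simpa only [tangentField_apply, tangentCoord_sphereTangent (hpq.homDen_pos z).ne'] using this

/-- The numerators have order 4d (2d from ψ and 2d from two factors p or q, possibly conjugated) and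
are divided by `homDen` squared, also of order 4d. -/
lemma IsCoprime.symbolGrowth_tangentField (hpq : IsCoprime p q) (hp : p ≠ 0) {ψ : ℂ[X]}
    (hψ : ψ.natDegree ≤ 2 * ratDegree p q) (n : ℕ) :
    SymbolGrowth n 0 (tangentField p q ψ) := by
  set d := ratDegree p q with hd
  have ga : SymbolGrowth n d fun z => p.eval z := .polynomial p (le_max_left _ _)
  have gb : SymbolGrowth n d fun z => q.eval z := .polynomial q (le_max_right _ _)
  have gψ : SymbolGrowth n (2 * d : ℕ) fun z => ψ.eval z := .polynomial ψ hψ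
  have hD (z : ℂ) : (homDen (p.eval z) (q.eval z) : ℂ)
      = p.eval z * conj (p.eval z) + q.eval z * conj (q.eval z) := by
    rw [homDen, mul_conj, mul_conj, ofReal_add]
  have gD : SymbolGrowth n (2 * d : ℕ) fun z => (homDen (p.eval z) (q.eval z) : ℂ) := by
    simp only [hD]
    exact ((ga.mul ga.star).add (gb.mul gb.star)).mono (by omega)
  obtain ⟨c, hc, hcD⟩ := hpq.exists_le_homDen hp
  have gM := gD.inv hc fun z => by
    rw [zpow_natCast, norm_real, Real.norm_of_nonneg (hpq.homDen_pos z).le]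
    exact hcD z
  have gV := ((((gψ.mul (ga.star.mul ga.star)).sub ((gb.mul gb).mul gψ.star |>.mono
    (by omega))).mul (gM.mul gM)).clm_comp
      (ContinuousLinearMap.pi ![(2 : ℝ) • reCLM, (2 : ℝ) • imCLM, 0])).mono (t := 0) (by omega)
  have gT := (((gψ.mul (ga.star.mul gb.star)).mul (gM.mul gM)).clm_comp
      (ContinuousLinearMap.pi ![0, 0, (4 : ℝ) • reCLM])).mono (t := 0) (by omega)
  have h1 (w : ℂ) (r : ℝ) : (w * ((r : ℂ)⁻¹ * (r : ℂ)⁻¹)) = w / ((r ^ 2 : ℝ) : ℂ) := by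
    rw [ofReal_pow, div_eq_mul_inv, sq, mul_inv]
  have hre (w : ℂ) (r : ℝ) : (w * ((r : ℂ)⁻¹ * (r : ℂ)⁻¹)).re = w.re / r ^ 2 := by
    rw [h1, div_ofReal_re]
  have him (w : ℂ) (r : ℝ) : (w * ((r : ℂ)⁻¹ * (r : ℂ)⁻¹)).im = w.im / r ^ 2 := by
    rw [h1, div_ofReal_im]
  convert gV.add gT using 1
  ext z i
  fin_cases i
  · change _ = (2 : ℝ) * (_ : ℂ).re + 0
    rw [hre, add_zero, tangentField_apply, ← mul_div_assoc, ← sq, ← sq]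
    rfl
  · change _ = (2 : ℝ) * (_ : ℂ).im + 0
    rw [him, add_zero, tangentField_apply, ← mul_div_assoc, ← sq, ← sq]
    rfl
  · change _ = 0 + (4 : ℝ) * (_ : ℂ).re
    rw [hre, zero_add, tangentField_apply, ← mul_div_assoc, ← mul_assoc (eval z ψ)]
    rfl

lemma IsCoprime.tangentField_mem_kerL1 (hpq : IsCoprime p q) (hp : p ≠ 0) {ψ : ℂ[X]}
    (hψ : ψ.natDegree ≤ 2 * ratDegree p q) :
    tangentField p q ψ ∈ kerL1 (ratSphere p q) := by
  have g := hpq.symbolGrowth_tangentField hp hψ 2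
  have hperp (z : ℂ) : ratSphere p q z ⬝ᵥ tangentField p q ψ z = 0 := by
    rw [hpq.ratSphere_eq]
    exact sphereHom_dot_sphereTangent _ _ _
  refine ⟨g.1, hperp, ?_, fun z => ?_⟩
  · obtain ⟨K₀, h₀⟩ := g.2 0 (by norm_num)
    obtain ⟨K₁, h₁⟩ := g.2 1 (by norm_num)
    obtain ⟨K₂, h₂⟩ := g.2 2 le_rfl
    refine ⟨K₀ + K₁ + K₂, fun z => add_le_add (add_le_add ?_ ?_) ?_⟩
    · simpa using h₀ z
    · simpa [norm_iteratedFDeriv_one] using h₁ z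
    · simpa using h₂ z
  · rw [hpq.L1_eq_zero_iff (g.1.of_le (by norm_num)) hperp]
    simp only [tangentField_apply, tangentCoord_sphereTangent (hpq.homDen_pos _).ne']
    exact ψ.differentiable.differentiableAt

lemma IsCoprime.exists_tangentField_eq (hpq : IsCoprime p q) {v : ℂ → Fin 3 → ℝ}
    (hv : v ∈ kerL1 (ratSphere p q)) :
    ∃ ψ : ℂ[X], ψ.natDegree ≤ 2 * ratDegree p q ∧ tangentField p q ψ = v := by
  obtain ⟨hv2, hperp, ⟨K, hK⟩, hL⟩ := hv
  have hdiff : Differentiable ℂ fun z => tangentCoord (p.eval z) (q.eval z) (v z) := fun z =>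
    (hpq.L1_eq_zero_iff (hv2.of_le (by norm_num)) hperp z).1 (hL z)
  have hgrowth (P : ℂ[X]) (hP : P.natDegree ≤ ratDegree p q) :
      ∃ M, ∀ z, ‖P.eval z‖ ≤ M * (1 + ‖z‖) ^ ratDegree p q := by
    obtain ⟨M, hM⟩ := (SymbolGrowth.zero_iff.1 (SymbolGrowth.polynomial (n := 0) P hP)).2
    exact ⟨M, fun z => by simpa using hM z⟩
  obtain ⟨M₁, h₁⟩ := hgrowth p (le_max_left _ _)
  obtain ⟨M₂, h₂⟩ := hgrowth q (le_max_right _ _)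
  have hbound (z : ℂ) : ‖tangentCoord (p.eval z) (q.eval z) (v z)‖
      ≤ 2 * (M₁ ^ 2 + M₂ ^ 2) * K * (1 + ‖z‖) ^ (2 * ratDegree p q) := by
    have hvK : ‖v z‖ ≤ K := by
      linarith [hK z, norm_nonneg (fderiv ℝ v z), norm_nonneg (iteratedFDeriv ℝ 2 v z)]
    have hD : homDen (p.eval z) (q.eval z)
        ≤ (M₁ ^ 2 + M₂ ^ 2) * (1 + ‖z‖) ^ (2 * ratDegree p q) := by
      rw [homDen, normSq_eq_norm_sq, normSq_eq_norm_sq, add_mul, mul_comm 2, pow_mul, ← mul_pow,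
        ← mul_pow]
      gcongr
      · exact h₁ z
      · exact h₂ z
    calc _ ≤ 2 * homDen (p.eval z) (q.eval z) * ‖v z‖ := norm_tangentCoord_le _ _ _
      _ ≤ 2 * ((M₁ ^ 2 + M₂ ^ 2) * (1 + ‖z‖) ^ (2 * ratDegree p q)) * K := by gcongr
      _ = _ := by ring
  obtain ⟨ψ, hψ, e⟩ := hdiff.exists_polynomial_of_norm_le _ hbound
  refine ⟨ψ, hψ, funext fun z => ?_⟩
  rw [tangentField_apply, ← e, sphereTangent_tangentCoord (hpq.homDen_pos z).ne']
  rw [← ratSphere_eq_sphereHom (hpq.eval_ne_zero_or z), hperp]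

lemma IsCoprime.kerL1_ratSphere (hpq : IsCoprime p q) (hp : p ≠ 0) :
    kerL1 (ratSphere p q)
      = ((degreeLT ℂ (2 * ratDegree p q + 1)).restrictScalars ℝ).map (tangentField p q) := by
  have hdeg (ψ : ℂ[X]) : ψ ∈ degreeLT ℂ (2 * ratDegree p q + 1)
      ↔ ψ.natDegree ≤ 2 * ratDegree p q := by
    rw [mem_degreeLT, degree_lt_iff_coeff_zero, natDegree_le_iff_coeff_eq_zero]
    rfl
  ext v
  simp only [Submodule.mem_map, Submodule.restrictScalars_mem, hdeg]
  constructor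
  · exact hpq.exists_tangentField_eq
  · rintro ⟨ψ, hψ, rfl⟩
    exact hpq.tangentField_mem_kerL1 hp hψ

lemma IsCoprime.finrank_kerL1 (hpq : IsCoprime p q) (hp : p ≠ 0) :
    Module.finrank ℝ (kerL1 (ratSphere p q)) = 4 * ratDegree p q + 2 := by
  have h1 : Module.finrank ℂ (degreeLT ℂ (2 * ratDegree p q + 1)) = 2 * ratDegree p q + 1 := by
    rw [(degreeLTEquiv ℂ _).finrank_eq, Module.finrank_fin_fun]
  rw [hpq.kerL1_ratSphere hp,
    ← (Submodule.equivMapOfInjective _ hpq.tangentField_injective _).finrank_eq]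
  have h2 := Module.finrank_mul_finrank ℝ ℂ (degreeLT ℂ (2 * ratDegree p q + 1))
  rw [h1, finrank_real_complex] at h2
  refine Eq.trans ?_ (h2.symm.trans (by ring))
  rfl

lemma IsCoprime.isCoeffVariation_iff (hpq : IsCoprime p q) (P Q : ℂ[X]) (v : ℂ → Fin 3 → ℝ) :
    IsCoeffVariation p q P Q v ↔ v = tangentField p q (p * Q - q * P) := by
  have key (z : ℂ) : HasDerivAt
      (fun t : ℝ => ratSphere (p + C (t : ℂ) * P) (q + C (t : ℂ) * Q) z)
      (tangentField p q (p * Q - q * P) z) 0 := by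
    have hline (a A : ℂ[X]) :
        HasDerivAt (fun t : ℝ => (a + C (t : ℂ) * A).eval z) (A.eval z) 0 := by
      simpa using hasDerivAt_add_mul (a.eval z) (A.eval z) 0
    have h := hasDerivAt_sphereHom (hline p P) (hline q Q)
      (by simpa using (hpq.homDen_pos z).ne')
    -- The perturbed polynomials may acquire common zeros, but at the fixed point z they do not
    -- vanish together for small t.
    have hne : ∀ᶠ t : ℝ in 𝓝 0,
        homDen ((p + C (t : ℂ) * P).eval z) ((q + C (t : ℂ) * Q).eval z) ≠ 0 := by
      refine ContinuousAt.eventually_ne ?_ (by simpa using (hpq.homDen_pos z).ne')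
      exact (continuous_normSq.continuousAt.comp (hline p P).continuousAt).add
        (continuous_normSq.continuousAt.comp (hline q Q).continuousAt)
    refine (h.congr_of_eventuallyEq ?_).congr_deriv ?_
    · filter_upwards [hne] with t ht
      refine ratSphere_eq_sphereHom ?_
      contrapose! ht
      simp [homDen, ht.1, ht.2]
    · simp [tangentField_apply]
  constructor
  · exact fun h => funext fun z => (h z).unique (key z)
  · rintro rfl
    exact key

lemma stereoCoord_sphereHom {a : ℂ} (ha : a ≠ 0) (b : ℂ) : stereoCoord (sphereHom a b) = b / a := by
  have h : (homDen a b : ℂ) ≠ 0 := ofReal_ne_zero.2 (homDen_pos (Or.inl ha)).ne'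
  have e : (homDen a b : ℂ) = a * conj a + b * conj b := by
    rw [homDen, mul_conj, mul_conj, ofReal_add]
  have ha' : conj a ≠ 0 := by simpa using ha
  have h1 : ((b * conj a).re : ℂ) + (b * conj a).im * I = b * conj a := re_add_im _
  have h2 : stereoCoord (sphereHom a b)
      = 2 * (((b * conj a).re : ℂ) + (b * conj a).im * I) / homDen a b
        / (2 * (a * conj a) / homDen a b) := by
    simp only [stereoCoord, sphereHom, Matrix.cons_val_zero, Matrix.cons_val_one, Matrix.cons_val,
      ofReal_div, ofReal_mul, ofReal_sub, ofReal_ofNat]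
    congr 1
    · ring
    · rw [eq_div_iff h, sub_mul, div_mul_cancel₀ _ h, e, mul_conj, mul_conj]
      ring
  rw [h2, h1]
  field_simp

/-- Keep a fixed and move b along b + tω/a, a direction with wedge ω; the affine coordinate b/a then
has velocity ω/a². -/
lemma fderiv_stereoCoord_sphereTangent {a : ℂ} (ha : a ≠ 0) (b ω : ℂ) :
    fderiv ℝ stereoCoord (sphereHom a b) (sphereTangent a b ω) = ω / a ^ 2 := by
  have hD := (homDen_pos (b := b) (Or.inl ha)).ne'
  have hdiff : DifferentiableAt ℝ stereoCoord (sphereHom a b) := by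
    have hc (i : Fin 3) : Differentiable ℝ fun s : Fin 3 → ℝ => (s i : ℂ) :=
      (ofRealCLM.comp (ContinuousLinearMap.proj (R := ℝ) (φ := fun _ : Fin 3 => ℝ) i)).differentiable
    have hn : DifferentiableAt ℝ (fun s : Fin 3 → ℝ => (s 0 : ℂ) + s 1 * I) (sphereHom a b) :=
      (hc 0).add ((hc 1).mul_const I) _
    have hd : DifferentiableAt ℝ (fun s : Fin 3 → ℝ => 1 - (s 2 : ℂ)) (sphereHom a b) :=
      (hc 2).const_sub 1 _
    refine hn.mul (hd.inv ?_)
    rw [← ofReal_one, ← ofReal_sub]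
    refine ofReal_ne_zero.2 ?_
    have h1 : normSq a ≠ 0 := (normSq_pos.2 ha).ne'
    have : 1 - sphereHom a b 2 = 2 * normSq a / homDen a b := by
      simp only [sphereHom, Matrix.cons_val]
      rw [eq_div_iff hD, sub_mul, div_mul_cancel₀ _ hD, homDen]
      ring
    rw [this]
    positivity
  have hb := hasDerivAt_add_mul b (ω / a) 0
  have h1 := hasDerivAt_sphereHom (hasDerivAt_const (0 : ℝ) a) hb (by simpa using hD)
  have h2 := hdiff.hasFDerivAt.comp_hasDerivAt_of_eq (0 : ℝ) h1 (by simp)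
  have h3 := h2.congr_of_eventuallyEq (f₁ := fun t : ℝ => (b + t * (ω / a)) / a)
    (.of_forall fun t => (stereoCoord_sphereHom ha _).symm)
  have h4 := h3.unique (hb.div_const a)
  simp only [ofReal_zero, zero_mul, add_zero, mul_zero, sub_zero, mul_div_cancel₀ _ ha] at h4
  rw [h4]
  field_simp

lemma IsCoprime.span_coeffVariations (hpq : IsCoprime p q) (hp : p ≠ 0) :
    kerL1 (ratSphere p q) = Submodule.span ℝ (coeffVariations p q (ratDegree p q)) := by
  apply le_antisymm
  · intro v hv
    obtain ⟨ψ, hψ, rfl⟩ := hpq.exists_tangentField_eq hv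
    obtain ⟨P, Q, hP, hQ, rfl⟩ := exists_mul_sub_mul_eq hpq hp hψ
    -- The monomials z^j and i z^j with j ≤ d span the polynomials of degree at most d over ℝ; this
    -- is used for Q ↦ pQ and P ↦ -qP, both followed by `tangentField`.
    have hmem {L : ℂ[X] →ₗ[ℝ] (ℂ → Fin 3 → ℝ)}
        (hL : ∀ j ≤ ratDegree p q, ∀ c : ℂ, (c = 1 ∨ c = I) →
          L (C c * X ^ j) ∈ Submodule.span ℝ (coeffVariations p q (ratDegree p q)))
        {R : ℂ[X]} (hR : R.natDegree ≤ ratDegree p q) :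
        L R ∈ Submodule.span ℝ (coeffVariations p q (ratDegree p q)) := by
      rw [R.as_sum_range_C_mul_X_pow' (Nat.lt_succ_of_le hR), map_sum]
      refine Submodule.sum_mem _ fun j hj => ?_
      have hj' : j ≤ ratDegree p q := Nat.lt_succ_iff.1 (Finset.mem_range.1 hj)
      have e : C (R.coeff j) * X ^ j = (R.coeff j).re • (C (1 : ℂ) * X ^ j)
          + (R.coeff j).im • (C I * X ^ j) := by
        rw [← smul_mul_assoc, ← smul_mul_assoc, smul_C, smul_C, ← add_mul, ← C_add, real_smul,
          real_smul, mul_one, re_add_im]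
      rw [e, map_add, map_smul, map_smul]
      exact add_mem (Submodule.smul_mem _ _ (hL j hj' 1 (Or.inl rfl)))
        (Submodule.smul_mem _ _ (hL j hj' I (Or.inr rfl)))
    rw [map_sub]
    refine sub_mem ?_ ?_
    · refine hmem (L := tangentField p q ∘ₗ LinearMap.mulLeft ℝ p) (fun j hj c hc => ?_) hQ
      refine Submodule.subset_span ⟨j, hj, c, hc, Or.inr ?_⟩
      rw [hpq.isCoeffVariation_iff]
      simp
    · rw [← neg_mem_iff, ← map_neg]
      have := hmem (L := tangentField p q ∘ₗ (-LinearMap.mulLeft ℝ q)) (fun j hj c hc => ?_) hP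
      · simpa using this
      refine Submodule.subset_span ⟨j, hj, c, hc, Or.inl ?_⟩
      rw [hpq.isCoeffVariation_iff]
      simp
  · refine Submodule.span_le.2 ?_
    rintro v ⟨j, hj, c, -, h⟩
    have hX : (C c * X ^ j : ℂ[X]).natDegree ≤ ratDegree p q := (natDegree_C_mul_X_pow_le c j).trans hj
    have hpd : p.natDegree ≤ ratDegree p q := le_max_left _ _
    have hqd : q.natDegree ≤ ratDegree p q := le_max_right _ _
    rw [hpq.isCoeffVariation_iff, hpq.isCoeffVariation_iff] at h
    rcases h with rfl | rfl
    · refine hpq.tangentField_mem_kerL1 hp ?_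
      rw [mul_zero, zero_sub, natDegree_neg]
      exact natDegree_mul_le.trans (by omega)
    · refine hpq.tangentField_mem_kerL1 hp ?_
      rw [mul_zero, sub_zero]
      exact natDegree_mul_le.trans (by omega)

end

end

theorem proposition4 (p q : ℂ[X]) (hp : p ≠ 0) (hpq : IsCoprime p q) (m : ℕ)
    (hm : sphereDegree (ratSphere p q) = (m : ℝ)) :
    -- the bounded kernel is generated by the derivatives in the coefficients of p and q
    kerL1 (ratSphere p q) = Submodule.span ℝ (coeffVariations p q m) ∧
    -- the kernel elements are exactly the variations of u through maps with moved coefficients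
    (∀ v : ℂ → Fin 3 → ℝ, v ∈ kerL1 (ratSphere p q) ↔
      ∃ P Q : ℂ[X], P.natDegree ≤ m ∧ Q.natDegree ≤ m ∧ IsCoeffVariation p q P Q v) ∧
    -- in the stereographic coordinate they are holomorphic off the poles of q/p
    (∀ v ∈ kerL1 (ratSphere p q),
      DifferentiableOn ℂ (fun z => fderiv ℝ stereoCoord (ratSphere p q z) (v z))
        {z | p.eval z ≠ 0}) ∧
    -- the real dimension
    Module.finrank ℝ (kerL1 (ratSphere p q)) = 4 * m + 2 := by
  obtain rfl : ratDegree p q = m := by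
    rw [hpq.sphereDegree_ratSphere hp] at hm
    exact_mod_cast hm
  refine ⟨hpq.span_coeffVariations hp, fun v => ⟨fun hv => ?_, ?_⟩, fun v hv => ?_,
    hpq.finrank_kerL1 hp⟩
  · obtain ⟨ψ, hψ, rfl⟩ := hpq.exists_tangentField_eq hv
    obtain ⟨P, Q, hP, hQ, rfl⟩ := exists_mul_sub_mul_eq hpq hp hψ
    exact ⟨P, Q, hP, hQ, (hpq.isCoeffVariation_iff P Q _).2 rfl⟩
  · rintro ⟨P, Q, hP, hQ, h⟩
    rw [(hpq.isCoeffVariation_iff P Q v).1 h]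
    have hpd : p.natDegree ≤ ratDegree p q := le_max_left _ _
    have hqd : q.natDegree ≤ ratDegree p q := le_max_right _ _
    refine hpq.tangentField_mem_kerL1 hp ((natDegree_sub_le _ _).trans (max_le ?_ ?_))
    · exact natDegree_mul_le.trans (by omega)
    · exact natDegree_mul_le.trans (by omega)
  · obtain ⟨ψ, -, rfl⟩ := hpq.exists_tangentField_eq hv
    have h : DifferentiableOn ℂ (fun z => ψ.eval z / p.eval z ^ 2) {z | p.eval z ≠ 0} :=
      ψ.differentiable.differentiableOn.div (p.differentiable.pow 2).differentiableOn
        fun z hz => pow_ne_zero 2 hz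
    refine h.congr fun z hz => ?_
    rw [tangentField_apply, ratSphere_eq_sphereHom (Or.inl hz),
      fderiv_stereoCoord_sphereTangent hz]
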